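/- Let $0<\alpha<\infty$ and $0<p<\infty$, and let $\mathbb{D}$ be the open unit disc in $\mathbb{C}$. For $f$ analytic in $\mathbb{D}$ put \[M_p^p(r,f)=\int_0^{2\pi}|f(re^{i\theta})|^p\,\frac{d\theta}{2\pi}\quad(0<r<1),\qquad \|f\|_{\alpha,p}^p=|f(0)|^p+\int_0^1\Big(\frac{d}{dr}M_p^p(r,f)\Big)(1-r^2)^{\alpha-1}\,dr\in[0,\infty],\] and let $A^p_\alpha$ be the class of all analytic functions $f$ in $\mathbb{D}$ with $\|f\|_{\alpha,p}<\infty$. Then for every $f\in A^p_\alpha$ and every $w\in\mathbb{D}$, \[|f(w)|^p(1-|w|^2)^\alpha\le\|f\|_{\alpha,p}^p .\] Moreover, for each $w\in\mathbb{D}$, a function $f$ belongs to $A^p_\alpha$ and attains equality in this bound at the point $w$ if and only if there is a constant $C\in\mathbb{C}$ such that $f(z)=C(1-\overline{w}z)^{-2\alpha/p}$ for all $z\in\mathbb{D}$, where the power is the principal branch. -/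

import Mathlib

open MeasureTheory

noncomputable section

/-- The integral mean `M_p^p(r, f) = (1 / 2π) ∫_0^{2π} |f (r e^{iθ})|^p dθ`. -/
def integralMeanPow (p : ℝ) (f : ℂ → ℂ) (r : ℝ) : ℝ :=
  Real.circleAverage (fun z : ℂ => ‖f z‖ ^ p) 0 r

/-- The quantity
`‖f‖_{α,p}^p = |f(0)|^p + ∫_0^1 (d/dr M_p^p(r, f)) (1 - r^2)^(α - 1) dr`,
as an element of `[0, ∞]`.  For `f` analytic in the unit disc the mean is differentiable and
nondecreasing on `(0, 1)`, so the integrand is nonnegative and the integral is a well-defined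
extended nonnegative number. -/
def dirichletNormPow (α p : ℝ) (f : ℂ → ℂ) : ENNReal :=
  ENNReal.ofReal (‖f 0‖ ^ p) +
    ∫⁻ r in Set.Ioo (0 : ℝ) 1,
      ENNReal.ofReal (deriv (integralMeanPow p f) r * (1 - r ^ 2) ^ (α - 1))

/-- The class `A^p_α` of all functions `f` analytic in the unit disc with `‖f‖_{α,p} < ∞`.
A function on the disc is represented by any extension of it to `ℂ`; only the values in the
disc matter. -/
def dirichletClass (α p : ℝ) : Set (ℂ → ℂ) :=
  {f | AnalyticOnNhd ℂ f (Metric.ball 0 1) ∧ dirichletNormPow α p f < ⊤}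

end

section

open Metric Complex Filter Topology Set
open scoped ComplexConjugate

/-! Write `M(s)` for the integral mean. Integration by parts on a disc of radius `ρ < 1`
(`truncNormPow_eq`) turns the truncated norm into a boundary term `M(ρ)(1-ρ²)^(α-1)` plus the
integral of `M` against `2(α-1)s(1-s²)^(α-2)`. The sign of `α - 1` splits the proof.

For `α ≤ 1` that weight is nonpositive. Dividing out zeros by Blaschke factors keeps `|f|` on the
circle and raises it inside, so it lowers the truncated norm (`truncNormPow_le_of_majorant`). A
zero-free `g` satisfies `|g|^p = |h|²` with `h` analytic. Parseval makes the truncated norm a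
weighted `ℓ²` sum of Taylor coefficients of `h` (`truncNormPow_eq_tsum`), and Cauchy–Schwarz bounds
`|h(w)|²` by that sum times a kernel, which tends to `(1-|w|²)^(-α)` as `ρ → 1`. A zero of `f` would
leave a Blaschke factor to spare, so a nonzero extremal function is zero-free, and the equality case
of Cauchy–Schwarz identifies `h`.

For `α > 1` the boundary term is dropped. What remains is the normalised Bergman integral of
`|f|^p`, which a weighted composition with the involution exchanging `0` and `w` preserves up to the
factor `(1-|w|²)^α` (`radialNormPow_weightedComp`). This reduces the bound to `w = 0`, where it is
`|F(0)|^p ≤ M(s)`; equality makes `F` constant (`eq_of_integralMeanPow_eq`).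

Conversely, the norm of a kernel function is computed from the binomial series, for every `α > 0`
(`dirichletNormPow_kernel`). -/

/-! ### Blaschke factors and zero-free majorants -/

theorem norm_sq_sub_conj_mul (ρ : ℝ) (a z : ℂ) :
    ‖(ρ : ℂ) ^ 2 - conj a * z‖ ^ 2 - ‖(ρ : ℂ) * (z - a)‖ ^ 2
      = (ρ ^ 2 - ‖a‖ ^ 2) * (ρ ^ 2 - ‖z‖ ^ 2) := by
  simp only [Complex.sq_norm, Complex.normSq_apply]
  simp [pow_two]
  ring

/-- The canonical factor is the reciprocal of a Blaschke factor: by `norm_sq_sub_conj_mul` its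
numerator dominates its denominator in modulus. -/
theorem one_le_norm_canonicalFactor {ρ : ℝ} {a z : ℂ} (ha : a ∈ ball (0 : ℂ) ρ)
    (hz : z ∈ closedBall (0 : ℂ) ρ) (hza : z ≠ a) : 1 ≤ ‖canonicalFactor ρ a z‖ := by
  simp only [mem_ball, mem_closedBall, dist_zero_right] at ha hz
  have hρ : 0 < ρ := (norm_nonneg a).trans_lt ha
  have h0 : 0 < ‖(ρ : ℂ) * (z - a)‖ := by
    rw [norm_pos_iff]; exact mul_ne_zero (by exact_mod_cast hρ.ne') (sub_ne_zero.2 hza)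
  rw [canonicalFactor_apply, norm_div, one_le_div h0]
  have := norm_sq_sub_conj_mul ρ a z
  have h1 : 0 ≤ (ρ ^ 2 - ‖a‖ ^ 2) * (ρ ^ 2 - ‖z‖ ^ 2) :=
    mul_nonneg (by nlinarith [norm_nonneg a]) (by nlinarith [norm_nonneg z])
  exact le_of_sq_le_sq (by linarith) (norm_nonneg _)

theorem one_lt_norm_canonicalFactor {ρ : ℝ} {a z : ℂ} (ha : a ∈ ball (0 : ℂ) ρ)
    (hz : z ∈ ball (0 : ℂ) ρ) (hza : z ≠ a) : 1 < ‖canonicalFactor ρ a z‖ := by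
  simp only [mem_ball, dist_zero_right] at ha hz
  have hρ : 0 < ρ := (norm_nonneg a).trans_lt ha
  have h0 : 0 < ‖(ρ : ℂ) * (z - a)‖ := by
    rw [norm_pos_iff]; exact mul_ne_zero (by exact_mod_cast hρ.ne') (sub_ne_zero.2 hza)
  rw [canonicalFactor_apply, norm_div, one_lt_div h0]
  have := norm_sq_sub_conj_mul ρ a z
  have h1 : 0 < (ρ ^ 2 - ‖a‖ ^ 2) * (ρ ^ 2 - ‖z‖ ^ 2) :=
    mul_pos (by nlinarith [norm_nonneg a]) (by nlinarith [norm_nonneg z])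
  exact lt_of_pow_lt_pow_left₀ 2 (norm_nonneg _) (by linarith)

/-- Dividing out the zero `a` of `f` by a Blaschke factor of the disc of radius `ρ`. -/
theorem exists_analyticOnNhd_div_zero {ρ : ℝ} {f : ℂ → ℂ} {a : ℂ}
    (hf : AnalyticOnNhd ℂ f (closedBall 0 ρ)) (ha : a ∈ ball (0 : ℂ) ρ)
    (hfa : f a = 0) (hne : ¬ ∀ᶠ z in 𝓝 a, f z = 0) :
    ∃ g : ℂ → ℂ, AnalyticOnNhd ℂ g (closedBall 0 ρ) ∧ g a ≠ 0 ∧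
      (∀ z ∈ closedBall (0 : ℂ) ρ, z ≠ a → ‖f z‖ * ‖canonicalFactor ρ a z‖ ≤ ‖g z‖) ∧
      ∀ z ∈ sphere (0 : ℂ) ρ, ‖f z‖ = ‖g z‖ := by
  have ha' : a ∈ closedBall (0 : ℂ) ρ := ball_subset_closedBall ha
  obtain ⟨k, g₀, hg₀, hg₀a, hfg⟩ :=
    (hf a ha').exists_eventuallyEq_pow_smul_nonzero_iff.2 hne
  have hρ : 0 < ρ := (norm_nonneg a).trans_lt (by simpa using ha)
  have hk : k ≠ 0 := by
    rintro rfl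
    have := hfg.self_of_nhds
    simp [hfa] at this
    exact hg₀a this.symm
  let u : ℂ → ℂ := fun z => ((ρ : ℂ) ^ 2 - conj a * z) / ρ
  have hua : u a ≠ 0 := by
    have : conj a * a = ((‖a‖ ^ 2 : ℝ) : ℂ) := by
      rw [mul_comm, Complex.mul_conj, Complex.normSq_eq_norm_sq]
    simp only [u, this]
    have h1 : ‖a‖ < ρ := by simpa using ha
    refine div_ne_zero ?_ (by exact_mod_cast hρ.ne')
    rw [sub_ne_zero]
    exact_mod_cast (show ρ ^ 2 ≠ ‖a‖ ^ 2 by nlinarith [norm_nonneg a])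
  -- Near `a`, `f = (z - a)^k g₀` and the canonical factor is `u / (z - a)`, so the product extends
  -- to `a` with value `g₀ a * u a ^ k`.
  let q : ℂ → ℂ := fun z => f z * canonicalFactor ρ a z ^ k
  let g : ℂ → ℂ := Function.update q a (g₀ a * u a ^ k)
  have hgz : ∀ z, z ≠ a → g z = q z := fun z hz => Function.update_of_ne hz _ _
  refine ⟨g, ?_, ?_, ?_, ?_⟩
  · intro z hz
    by_cases hza : z = a
    · subst hza
      have h1 : AnalyticAt ℂ (fun w => g₀ w * u w ^ k) z := by
        refine hg₀.mul (AnalyticAt.pow ?_ k)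
        simp only [u]
        fun_prop (disch := exact_mod_cast hρ.ne')
      refine h1.congr ?_
      filter_upwards [hfg] with w hw
      by_cases hwz : w = z
      · subst hwz; simp [g]
      · rw [hgz w hwz]
        simp only [q, hw, u, canonicalFactor_apply, smul_eq_mul]
        have : w - z ≠ 0 := sub_ne_zero.2 hwz
        have hρ' : (ρ : ℂ) ≠ 0 := by exact_mod_cast hρ.ne'
        rw [div_pow, div_pow, mul_pow]
        field_simp
    · have h1 : AnalyticAt ℂ q z :=
        (hf z hz).mul ((analyticOnNhd_canonicalFactor ρ a z hza).pow k)
      refine h1.congr ?_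
      filter_upwards [isOpen_ne.mem_nhds hza] with w hw
      exact (hgz w hw).symm
  · simp only [g, Function.update_self]
    exact mul_ne_zero hg₀a (pow_ne_zero _ hua)
  · intro z hz hza
    rw [hgz z hza]
    simp only [q, norm_mul, norm_pow]
    gcongr
    exact le_self_pow₀ (one_le_norm_canonicalFactor ha hz hza) hk
  · intro z hz
    have hza : z ≠ a := by
      rintro rfl
      simp only [mem_ball, mem_sphere] at ha hz
      linarith
    rw [hgz z hza]
    simp [q, norm_canonicalFactor_eval_circle_eq_one ha hz]

theorem finite_zeros_closedBall {ρ : ℝ} {f : ℂ → ℂ}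
    (hf : AnalyticOnNhd ℂ f (closedBall 0 ρ)) (hne : ∃ z ∈ closedBall (0 : ℂ) ρ, f z ≠ 0) :
    {z ∈ closedBall (0 : ℂ) ρ | f z = 0}.Finite := by
  by_contra h
  obtain ⟨x, hx, hacc⟩ := Set.Infinite.exists_accPt_of_subset_isCompact h
    (isCompact_closedBall (0 : ℂ) ρ) (fun z hz => hz.1)
  obtain ⟨z, hz, hfz⟩ := hne
  refine hfz (hf.eqOn_zero_of_preconnected_of_frequently_eq_zero
    (convex_closedBall (0 : ℂ) ρ).isPreconnected hx ?_ hz)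
  rw [accPt_iff_frequently_nhdsNE] at hacc
  exact hacc.mono fun y hy => hy.2

theorem not_eventually_eq_zero_of_ne_zero {ρ : ℝ} {f : ℂ → ℂ}
    (hf : AnalyticOnNhd ℂ f (closedBall 0 ρ)) (hne : ∃ z ∈ closedBall (0 : ℂ) ρ, f z ≠ 0)
    {a : ℂ} (ha : a ∈ closedBall (0 : ℂ) ρ) : ¬ ∀ᶠ z in 𝓝 a, f z = 0 := by
  intro h
  obtain ⟨z, hz, hfz⟩ := hne
  exact hfz (hf.eqOn_zero_of_preconnected_of_eventuallyEq_zero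
    (convex_closedBall (0 : ℂ) ρ).isPreconnected ha h hz)

/-- A function analytic on a closed disc has a majorant without zeros in the open disc and
with the same modulus on the circle. -/
theorem exists_zeroFree_majorant {ρ : ℝ} {f : ℂ → ℂ}
    (hf : AnalyticOnNhd ℂ f (closedBall 0 ρ)) (hne : ∃ z ∈ closedBall (0 : ℂ) ρ, f z ≠ 0) :
    ∃ g : ℂ → ℂ, AnalyticOnNhd ℂ g (closedBall 0 ρ) ∧ (∀ z ∈ ball (0 : ℂ) ρ, g z ≠ 0) ∧
      (∀ z ∈ closedBall (0 : ℂ) ρ, ‖f z‖ ≤ ‖g z‖) ∧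
      ∀ z ∈ sphere (0 : ℂ) ρ, ‖f z‖ = ‖g z‖ := by
  -- The induction runs over any finite set containing the zeros. Dividing out one zero creates no
  -- others, because `‖f‖ ≤ ‖g‖` forces zeros of `g` to be zeros of `f`.
  obtain ⟨Z, hZ⟩ : ∃ Z : Finset ℂ, ∀ z ∈ ball (0 : ℂ) ρ, f z = 0 → z ∈ Z :=
    ⟨(finite_zeros_closedBall hf hne).toFinset, fun z hz h0 => by
      simpa [h0] using (by simpa using hz : ‖z‖ < ρ).le⟩
  induction Z using Finset.induction_on generalizing f with
  | empty => exact ⟨f, hf, fun z hz h => by simpa using hZ z hz h, fun _ _ => le_rfl,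
      fun _ _ => rfl⟩
  | insert a Z haZ ih =>
    by_cases h : a ∈ ball (0 : ℂ) ρ ∧ f a = 0
    · obtain ⟨ha, hfa⟩ := h
      obtain ⟨g, hg, hga, hfg, hfg'⟩ := exists_analyticOnNhd_div_zero hf ha hfa
        (not_eventually_eq_zero_of_ne_zero hf hne (ball_subset_closedBall ha))
      have hle : ∀ z ∈ closedBall (0 : ℂ) ρ, ‖f z‖ ≤ ‖g z‖ := by
        intro z hz
        by_cases hza : z = a
        · simp [hza, hfa]
        · exact (le_mul_of_one_le_right (norm_nonneg _)
            (one_le_norm_canonicalFactor ha hz hza)).trans (hfg z hz hza)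
      obtain ⟨G, hG, hG0, hgG, hgG'⟩ := ih hg ⟨a, ball_subset_closedBall ha, hga⟩ (by
        intro z hz hgz
        have hza : z ≠ a := by rintro rfl; exact hga hgz
        have : f z = 0 := by
          simpa [hgz] using hle z (ball_subset_closedBall hz)
        exact (Finset.mem_insert.1 (hZ z hz this)).resolve_left hza)
      exact ⟨G, hG, hG0, fun z hz => (hle z hz).trans (hgG z hz),
        fun z hz => (hfg' z hz).trans (hgG' z hz)⟩
    · refine ih hf hne fun z hz h0 => (Finset.mem_insert.1 (hZ z hz h0)).resolve_left ?_
      rintro rfl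
      exact h ⟨hz, h0⟩

/-- If `f` vanishes at `a`, the zero-free majorant gains the reciprocal of a Blaschke factor. -/
theorem exists_zeroFree_majorant_of_zero {ρ : ℝ} {f : ℂ → ℂ} {a : ℂ}
    (hf : AnalyticOnNhd ℂ f (closedBall 0 ρ)) (hne : ∃ z ∈ closedBall (0 : ℂ) ρ, f z ≠ 0)
    (ha : a ∈ ball (0 : ℂ) ρ) (hfa : f a = 0) :
    ∃ g : ℂ → ℂ, AnalyticOnNhd ℂ g (closedBall 0 ρ) ∧ (∀ z ∈ ball (0 : ℂ) ρ, g z ≠ 0) ∧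
      (∀ z ∈ closedBall (0 : ℂ) ρ, ‖f z‖ * ‖canonicalFactor ρ a z‖ ≤ ‖g z‖) ∧
      (∀ z ∈ closedBall (0 : ℂ) ρ, ‖f z‖ ≤ ‖g z‖) ∧
      ∀ z ∈ sphere (0 : ℂ) ρ, ‖f z‖ = ‖g z‖ := by
  obtain ⟨g, hg, hga, hfg, hfg'⟩ := exists_analyticOnNhd_div_zero hf ha hfa
    (not_eventually_eq_zero_of_ne_zero hf hne (ball_subset_closedBall ha))
  obtain ⟨G, hG, hG0, hgG, hgG'⟩ :=
    exists_zeroFree_majorant hg ⟨a, ball_subset_closedBall ha, hga⟩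
  have key : ∀ z ∈ closedBall (0 : ℂ) ρ, ‖f z‖ * ‖canonicalFactor ρ a z‖ ≤ ‖G z‖ := by
    intro z hz
    by_cases hza : z = a
    · simp [hza, hfa]
    · exact (hfg z hz hza).trans (hgG z hz)
  refine ⟨G, hG, hG0, key, fun z hz => ?_, fun z hz => (hfg' z hz).trans (hgG' z hz)⟩
  by_cases hza : z = a
  · simp [hza, hfa]
  · exact (le_mul_of_one_le_right (norm_nonneg _)
      (one_le_norm_canonicalFactor ha hz hza)).trans (key z hz)

/-! ### Logarithms of zero-free functions -/

/-- `L` is the primitive of `f'/f` with `L 0 = log (f 0)`; then `f * exp (-L)` has zero derivative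
and equals `1` at the origin. -/
theorem exists_exp_eq_of_ne_zero {ρ : ℝ} {f : ℂ → ℂ} (hf : DifferentiableOn ℂ f (ball 0 ρ))
    (h0 : ∀ z ∈ ball (0 : ℂ) ρ, f z ≠ 0) :
    ∃ L : ℂ → ℂ, DifferentiableOn ℂ L (ball 0 ρ) ∧ ∀ z ∈ ball (0 : ℂ) ρ, f z = exp (L z) := by
  rcases le_or_gt ρ 0 with hρ | hρ
  · exact ⟨f, hf, by simp [ball_eq_empty.2 hρ]⟩
  have h00 : (0 : ℂ) ∈ ball (0 : ℂ) ρ := mem_ball_self hρ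
  have hd : DifferentiableOn ℂ (fun z => deriv f z / f z) (ball 0 ρ) :=
    (hf.deriv isOpen_ball).div hf h0
  obtain ⟨L, hL0, hL⟩ := hd.isExactOn_ball.with_val_at (0 : ℂ) (log (f 0))
  refine ⟨L, fun z hz => (hL z hz).differentiableAt.differentiableWithinAt, ?_⟩
  have hder : ∀ z ∈ ball (0 : ℂ) ρ, HasDerivAt (fun z => f z * exp (-L z)) 0 z := by
    intro z hz
    have h1 := (hf.differentiableAt (isOpen_ball.mem_nhds hz)).hasDerivAt.mul
      ((hL z hz).neg.cexp)
    have h2 : deriv f z * exp ((-L) z) + f z * (exp ((-L) z) * -(deriv f z / f z)) = 0 := by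
      have := h0 z hz
      field_simp
      ring
    rw [h2] at h1
    exact h1
  intro z hz
  have hconst : f z * exp (-L z) = f 0 * exp (-L 0) :=
    isOpen_ball.is_const_of_deriv_eq_zero (convex_ball (0 : ℂ) ρ).isPreconnected
      (fun w hw => (hder w hw).differentiableAt.differentiableWithinAt)
      (fun w hw => (hder w hw).deriv) hz h00
  rw [hL0, exp_neg, exp_neg, exp_log (h0 0 h00), mul_inv_cancel₀ (h0 0 h00)] at hconst
  exact (mul_inv_eq_one₀ (exp_ne_zero _)).1 hconst

theorem norm_exp_rpow (p : ℝ) (z : ℂ) : ‖exp z‖ ^ p = ‖exp ((p / 2 : ℝ) * z)‖ ^ 2 := by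
  rw [norm_exp, norm_exp, ← Real.exp_mul, ← Real.exp_nat_mul]
  congr 1
  simp
  ring

/-! ### Taylor coefficients and Parseval's identity -/

/-- Taylor coefficients at the origin. -/
noncomputable def taylorCoeff (h : ℂ → ℂ) (n : ℕ) : ℂ := (n.factorial : ℂ)⁻¹ * iteratedDeriv n h 0

theorem hasSum_taylorCoeff {ρ : ℝ} {h : ℂ → ℂ} (hh : DifferentiableOn ℂ h (ball 0 ρ))
    {z : ℂ} (hz : z ∈ ball (0 : ℂ) ρ) : HasSum (fun n => taylorCoeff h n * z ^ n) (h z) := by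
  have := hasSum_taylorSeries_on_ball hh hz
  refine this.congr_fun ?_
  intro n
  simp [taylorCoeff]
  ring

theorem summable_norm_taylorCoeff {ρ : ℝ} {h : ℂ → ℂ} (hh : DifferentiableOn ℂ h (ball 0 ρ))
    {s : ℝ} (hs0 : 0 ≤ s) (hs : s < ρ) : Summable fun n => ‖taylorCoeff h n‖ * s ^ n := by
  have h1 := (hasSum_taylorCoeff hh (z := (s : ℂ)) (by simpa [abs_of_nonneg hs0])).summable.norm
  refine h1.congr fun n => ?_
  simp [abs_of_nonneg hs0]

theorem summable_norm_sq_taylorCoeff {ρ : ℝ} {h : ℂ → ℂ} (hh : DifferentiableOn ℂ h (ball 0 ρ))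
    {s : ℝ} (hs0 : 0 ≤ s) (hs : s < ρ) :
    Summable fun n => ‖taylorCoeff h n‖ ^ 2 * s ^ (2 * n) := by
  have h1 := summable_norm_taylorCoeff hh hs0 hs
  have h2 : Summable fun n => (‖taylorCoeff h n‖ * s ^ n) * (‖taylorCoeff h n‖ * s ^ n) :=
    Summable.of_nonneg_of_le (fun n => by positivity)
      (fun n => mul_le_mul_of_nonneg_right
        (h1.le_tsum n (fun j _ => by positivity)) (by positivity))
      (h1.mul_left (∑' n, ‖taylorCoeff h n‖ * s ^ n))
  refine h2.congr fun n => ?_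
  rw [pow_mul']; ring

/-- Parseval's identity on circles for analytic functions. -/
theorem circleAverage_norm_sq {ρ : ℝ} {h : ℂ → ℂ} (hh : DifferentiableOn ℂ h (ball 0 ρ))
    {s : ℝ} (hs0 : 0 ≤ s) (hs : s < ρ) :
    Real.circleAverage (fun z => ‖h z‖ ^ 2) 0 s = ∑' n, ‖taylorCoeff h n‖ ^ 2 * s ^ (2 * n) := by
  set a := taylorCoeff h with ha
  have hsum := summable_norm_taylorCoeff hh hs0 hs
  rw [← ha] at hsum
  set S := ∑' n, ‖a n‖ * s ^ n with hS
  -- The radius is absorbed into the coefficients, so Parseval for polynomials on the unit circle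
  -- applies to the partial sums. Absolute convergence bounds them by `S`, and dominated convergence
  -- gives the limit.
  let P : ℕ → Polynomial ℂ := fun N =>
    ∑ n ∈ Finset.range N, Polynomial.monomial n (a n * (s : ℂ) ^ n)
  have hcoeff : ∀ N n, (P N).coeff n = if n < N then a n * (s : ℂ) ^ n else 0 := by
    intro N n
    simp [P, Polynomial.coeff_monomial]
  have heval : ∀ N z, (P N).eval z = ∑ n ∈ Finset.range N, a n * (s : ℂ) ^ n * z ^ n := by
    intro N z
    simp [P, Polynomial.eval_finsetSum, Polynomial.eval_monomial]
  have hnorm : ∀ N, ∑ n ∈ Finset.range N, ‖a n‖ ^ 2 * s ^ (2 * n)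
      = Real.circleAverage (fun z => ‖(P N).eval z‖ ^ 2) 0 1 := by
    intro N
    rw [← Polynomial.sum_sq_norm_coeff_eq_circleAverage]
    rw [Finset.sum_subset (s₁ := (P N).support) (s₂ := Finset.range N)]
    · refine Finset.sum_congr rfl fun n hn => ?_
      rw [hcoeff, if_pos (Finset.mem_range.1 hn)]
      simp only [norm_mul, norm_pow, norm_real, Real.norm_of_nonneg hs0]
      ring
    · intro n hn
      rw [Polynomial.mem_support_iff, hcoeff] at hn
      by_contra h
      rw [Finset.mem_range] at h
      simp [h] at hn
    · intro n _ hn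
      rw [Polynomial.notMem_support_iff] at hn
      simp [hn]
  have hlim1 : Tendsto (fun N => ∑ n ∈ Finset.range N, ‖a n‖ ^ 2 * s ^ (2 * n)) atTop
      (𝓝 (∑' n, ‖a n‖ ^ 2 * s ^ (2 * n))) :=
    (summable_norm_sq_taylorCoeff hh hs0 hs).hasSum.tendsto_sum_nat
  have hmem : ∀ θ : ℝ, (s : ℂ) * circleMap 0 1 θ ∈ ball (0 : ℂ) ρ := by
    intro θ
    simpa [abs_of_nonneg hs0] using hs
  have hlim2 : Tendsto (fun N => Real.circleAverage (fun z => ‖(P N).eval z‖ ^ 2) 0 1) atTop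
      (𝓝 (Real.circleAverage (fun z => ‖h ((s : ℂ) * z)‖ ^ 2) 0 1)) := by
    simp only [Real.circleAverage_def]
    refine Tendsto.const_smul ?_ _
    refine intervalIntegral.tendsto_integral_filter_of_dominated_convergence (fun _ => S ^ 2)
      ?_ ?_ ?_ ?_
    · refine Eventually.of_forall fun N => Continuous.aestronglyMeasurable ?_
      have : Continuous (circleMap 0 1) := continuous_circleMap 0 1
      fun_prop
    · refine Eventually.of_forall fun N => Eventually.of_forall fun θ _ => ?_
      rw [norm_pow, norm_norm, heval]
      gcongr
      refine (norm_sum_le _ _).trans ?_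
      rw [hS]
      refine le_trans (Finset.sum_le_sum fun n _ => ?_)
        (hsum.sum_le_tsum (Finset.range N) fun n _ => by positivity)
      simp [abs_of_nonneg hs0]
    · exact intervalIntegrable_const
    · refine Eventually.of_forall fun θ _ => ?_
      refine (Tendsto.norm ?_).pow 2
      have := (hasSum_taylorCoeff hh (hmem θ)).tendsto_sum_nat
      refine this.congr fun N => ?_
      rw [heval]
      refine Finset.sum_congr rfl fun n _ => ?_
      rw [mul_pow]; ring
  have := tendsto_nhds_unique (hlim1.congr hnorm) hlim2
  rw [this, Real.circleAverage_eq_circleAverage_zero_one]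
  simp

/-- The integral means of a zero-free function through the Taylor coefficients of a power of it. -/
theorem integralMeanPow_eq_tsum {p ρ : ℝ} {f h : ℂ → ℂ} (hh : DifferentiableOn ℂ h (ball 0 ρ))
    (hfh : ∀ z ∈ ball (0 : ℂ) ρ, ‖f z‖ ^ p = ‖h z‖ ^ 2) {s : ℝ} (hs0 : 0 ≤ s) (hs : s < ρ) :
    integralMeanPow p f s = ∑' n, ‖taylorCoeff h n‖ ^ 2 * s ^ (2 * n) := by
  rw [← circleAverage_norm_sq hh hs0 hs, integralMeanPow]
  refine Real.circleAverage_congr_sphere fun z hz => hfh z ?_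
  rw [abs_of_nonneg hs0] at hz
  simp only [mem_sphere, dist_zero_right] at hz
  simpa [hz] using hs

/-- Passage from the exponent `p` to the Hilbert space exponent `2`: `h = exp (pL/2)` for a
logarithm `L` of `f`. This is what requires `f` to have no zeros. -/
theorem exists_sq_eq_rpow {p ρ : ℝ} {f : ℂ → ℂ} (hf : DifferentiableOn ℂ f (ball 0 ρ))
    (h0 : ∀ z ∈ ball (0 : ℂ) ρ, f z ≠ 0) :
    ∃ h : ℂ → ℂ, DifferentiableOn ℂ h (ball 0 ρ) ∧
      ∀ z ∈ ball (0 : ℂ) ρ, ‖f z‖ ^ p = ‖h z‖ ^ 2 := by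
  obtain ⟨L, hL, hfL⟩ := exists_exp_eq_of_ne_zero hf h0
  refine ⟨fun z => exp ((p / 2 : ℝ) * L z), (hL.const_mul _).cexp, fun z hz => ?_⟩
  rw [hfL z hz, norm_exp_rpow]

/-! ### Regularity and monotonicity of the integral means -/

theorem continuousOn_norm_rpow {p ρ : ℝ} (hp : 0 < p) {f : ℂ → ℂ}
    (hf : AnalyticOnNhd ℂ f (closedBall 0 ρ)) :
    ContinuousOn (fun z => ‖f z‖ ^ p) (closedBall 0 ρ) :=
  hf.continuousOn.norm.rpow_const fun _ _ => Or.inr hp.le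

theorem continuousOn_integralMeanPow {p ρ : ℝ} (hp : 0 < p) {f : ℂ → ℂ}
    (hf : AnalyticOnNhd ℂ f (closedBall 0 ρ)) :
    ContinuousOn (integralMeanPow p f) (Icc 0 ρ) := by
  refine Real.ContinuousOn.circleAverage ?_ fun r hr => hr.1
  refine (continuousOn_norm_rpow hp hf).mono fun z hz => ?_
  simpa using hz.2

theorem circleIntegrable_norm_rpow {p ρ : ℝ} (hp : 0 < p) {f : ℂ → ℂ}
    (hf : AnalyticOnNhd ℂ f (closedBall 0 ρ)) {s : ℝ} (hs0 : 0 ≤ s) (hs : s ≤ ρ) :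
    CircleIntegrable (fun z => ‖f z‖ ^ p) 0 s :=
  ((continuousOn_norm_rpow hp hf).mono
    (sphere_subset_closedBall.trans (closedBall_subset_closedBall hs))).circleIntegrable hs0

theorem integralMeanPow_nonneg (p : ℝ) (f : ℂ → ℂ) (s : ℝ) : 0 ≤ integralMeanPow p f s :=
  Real.circleAverage_nonneg_of_nonneg fun _ _ => Real.rpow_nonneg (norm_nonneg _) _

theorem integralMeanPow_mono_fun {p ρ : ℝ} (hp : 0 < p) {f g : ℂ → ℂ}
    (hf : AnalyticOnNhd ℂ f (closedBall 0 ρ)) (hg : AnalyticOnNhd ℂ g (closedBall 0 ρ))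
    (hfg : ∀ z ∈ closedBall (0 : ℂ) ρ, ‖f z‖ ≤ ‖g z‖) {s : ℝ} (hs0 : 0 ≤ s) (hs : s ≤ ρ) :
    integralMeanPow p f s ≤ integralMeanPow p g s := by
  refine Real.circleAverage_mono (circleIntegrable_norm_rpow hp hf hs0 hs)
    (circleIntegrable_norm_rpow hp hg hs0 hs) fun z hz => ?_
  rw [abs_of_nonneg hs0] at hz
  exact Real.rpow_le_rpow (norm_nonneg _)
    (hfg z (closedBall_subset_closedBall hs (sphere_subset_closedBall hz))) hp.le

theorem integralMeanPow_congr_sphere {p : ℝ} {f g : ℂ → ℂ} {s : ℝ} (hs0 : 0 ≤ s)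
    (hfg : ∀ z ∈ sphere (0 : ℂ) s, ‖f z‖ = ‖g z‖) :
    integralMeanPow p f s = integralMeanPow p g s := by
  refine Real.circleAverage_congr_sphere fun z hz => ?_
  rw [abs_of_nonneg hs0] at hz
  simp only [hfg z hz]

theorem integralMeanPow_zero (p : ℝ) (f : ℂ → ℂ) : integralMeanPow p f 0 = ‖f 0‖ ^ p := by
  simp [integralMeanPow]

theorem integralMeanPow_le_of_zeroFree {p ρ : ℝ} (hp : 0 < p) {g : ℂ → ℂ}
    (hg : AnalyticOnNhd ℂ g (closedBall 0 ρ)) (h0 : ∀ z ∈ ball (0 : ℂ) ρ, g z ≠ 0)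
    {s : ℝ} (hs0 : 0 ≤ s) (hs : s ≤ ρ) :
    integralMeanPow p g s ≤ integralMeanPow p g ρ := by
  rcases hs.eq_or_lt with rfl | hs
  · exact le_rfl
  obtain ⟨h, hh, hgh⟩ := exists_sq_eq_rpow (p := p)
    (hg.differentiableOn.mono ball_subset_closedBall) h0
  -- `h` is only available on the open disc, so the radius `ρ` is reached as a limit of radii `t <
  -- ρ`, where the power series with nonnegative coefficients is visibly increasing.
  have hcont := (continuousOn_integralMeanPow hp hg) ρ (right_mem_Icc.2 (hs0.trans hs.le))
  have hlim : Tendsto (integralMeanPow p g) (𝓝[Ioo s ρ] ρ) (𝓝 (integralMeanPow p g ρ)) :=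
    hcont.mono_left (nhdsWithin_mono _ fun x hx => ⟨hs0.trans hx.1.le, hx.2.le⟩)
  have : (𝓝[Ioo s ρ] ρ).NeBot := by
    rw [← mem_closure_iff_nhdsWithin_neBot, closure_Ioo hs.ne]
    exact right_mem_Icc.2 hs.le
  refine ge_of_tendsto hlim ?_
  filter_upwards [self_mem_nhdsWithin] with t ht
  have ht0 : 0 ≤ t := hs0.trans ht.1.le
  rw [integralMeanPow_eq_tsum hh hgh hs0 hs, integralMeanPow_eq_tsum hh hgh ht0 ht.2]
  refine Summable.tsum_le_tsum (fun n => ?_) (summable_norm_sq_taylorCoeff hh hs0 hs)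
    (summable_norm_sq_taylorCoeff hh ht0 ht.2)
  have := ht.1.le
  gcongr

theorem integralMeanPow_eq_zero {p : ℝ} (hp : 0 < p) {f : ℂ → ℂ} {s : ℝ} (hs0 : 0 ≤ s)
    (h : ∀ z ∈ sphere (0 : ℂ) s, f z = 0) : integralMeanPow p f s = 0 := by
  refine Real.circleAverage_const_on_circle fun z hz => ?_
  rw [abs_of_nonneg hs0] at hz
  simp [h z hz, Real.zero_rpow hp.ne']

/-- The zero-free majorant has a larger mean at `s` and the same mean at `ρ`, which reduces the
claim to the zero-free case. -/
theorem integralMeanPow_le {p ρ : ℝ} (hp : 0 < p) {f : ℂ → ℂ}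
    (hf : AnalyticOnNhd ℂ f (closedBall 0 ρ)) {s : ℝ} (hs0 : 0 ≤ s) (hs : s ≤ ρ) :
    integralMeanPow p f s ≤ integralMeanPow p f ρ := by
  by_cases hne : ∃ z ∈ closedBall (0 : ℂ) ρ, f z ≠ 0
  · obtain ⟨g, hg, hg0, hfg, hfg'⟩ := exists_zeroFree_majorant hf hne
    calc integralMeanPow p f s ≤ integralMeanPow p g s :=
          integralMeanPow_mono_fun hp hf hg hfg hs0 hs
      _ ≤ integralMeanPow p g ρ := integralMeanPow_le_of_zeroFree hp hg hg0 hs0 hs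
      _ = integralMeanPow p f ρ :=
          (integralMeanPow_congr_sphere (hs0.trans hs) hfg').symm
  · push Not at hne
    rw [integralMeanPow_eq_zero hp hs0 fun z hz => hne z
      (closedBall_subset_closedBall hs (sphere_subset_closedBall hz))]
    exact integralMeanPow_nonneg _ _ _

theorem monotoneOn_integralMeanPow {p ρ : ℝ} (hp : 0 < p) {f : ℂ → ℂ}
    (hf : AnalyticOnNhd ℂ f (closedBall 0 ρ)) : MonotoneOn (integralMeanPow p f) (Icc 0 ρ) :=
  fun _ hs _ ht hst => integralMeanPow_le hp
    (hf.mono (closedBall_subset_closedBall ht.2)) hs.1 hst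

theorem hasDerivAt_norm_rpow_circleMap {p : ℝ} {f : ℂ → ℂ} {r θ : ℝ}
    (hf : AnalyticAt ℂ f (circleMap 0 r θ)) (h0 : f (circleMap 0 r θ) ≠ 0) :
    HasDerivAt (fun r => ‖f (circleMap 0 r θ)‖ ^ p)
      (2 * inner ℝ (f (circleMap 0 r θ)) (deriv f (circleMap 0 r θ) * exp (θ * I)) * (p / 2)
        * (‖f (circleMap 0 r θ)‖ ^ 2) ^ (p / 2 - 1)) r := by
  have h1 : HasDerivAt (fun r : ℝ => circleMap 0 r θ) (exp (θ * I)) r := by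
    have := (hasDerivAt_id r).ofReal_comp.mul_const (exp (θ * I))
    simpa [circleMap] using this
  have h2 : HasDerivAt (fun r : ℝ => f (circleMap 0 r θ))
      (deriv f (circleMap 0 r θ) * exp (θ * I)) r := by
    have := HasDerivAt.scomp r hf.differentiableAt.hasDerivAt h1
    rw [smul_eq_mul, mul_comm] at this
    exact this
  have h3 := h2.norm_sq.rpow_const (p := p / 2) (Or.inl (by positivity))
  refine h3.congr_of_eventuallyEq (Eventually.of_forall fun r => ?_)
  simp only
  rw [← Real.rpow_natCast, ← Real.rpow_mul (norm_nonneg _)]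
  congr 1
  simp
  ring

/-- Without zeros on the circle, some compact thickening `K` of it avoids the zeros too. There the
radial derivative of `‖f‖ ^ p` is bounded, which justifies differentiating under the integral. -/
theorem differentiableAt_integralMeanPow {p ρ : ℝ} {f : ℂ → ℂ}
    (hf : AnalyticOnNhd ℂ f (closedBall 0 ρ)) {s : ℝ} (hs0 : 0 < s) (hs : s < ρ)
    (h0 : ∀ z ∈ sphere (0 : ℂ) s, f z ≠ 0) :
    DifferentiableAt ℝ (integralMeanPow p f) s := by
  have hcont : ContinuousOn f (ball 0 ρ) := hf.continuousOn.mono ball_subset_closedBall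
  let U : Set ℂ := ball 0 ρ ∩ f ⁻¹' {0}ᶜ
  have hU : IsOpen U := hcont.isOpen_inter_preimage isOpen_ball isOpen_compl_singleton
  have hsU : sphere (0 : ℂ) s ⊆ U := fun z hz => ⟨by simp at hz; simpa [hz] using hs, h0 z hz⟩
  obtain ⟨δ, hδ, hδU⟩ := (isCompact_sphere (0 : ℂ) s).exists_cthickening_subset_open hU hsU
  set K := cthickening δ (sphere (0 : ℂ) s) with hK
  have hKc : IsCompact K := (isCompact_sphere (0 : ℂ) s).cthickening
  have hmem : ∀ r ∈ ball s δ, ∀ θ, circleMap 0 r θ ∈ K := by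
    intro r hr θ
    refine mem_cthickening_of_dist_le _ (circleMap 0 s θ) _ _
      (circleMap_mem_sphere 0 hs0.le θ) ?_
    rw [dist_eq_norm]
    have : circleMap 0 r θ - circleMap 0 s θ = ((r - s : ℝ) : ℂ) * exp (θ * I) := by
      simp [circleMap]; ring
    rw [this, norm_mul, norm_exp_ofReal_mul_I, mul_one, norm_real]
    exact (mem_ball_iff_norm.1 hr).le
  have hfK : ContinuousOn f K := hcont.mono fun z hz => (hδU hz).1
  have hdK : ContinuousOn (deriv f) K :=
    hf.deriv.continuousOn.mono fun z hz => ball_subset_closedBall (hδU hz).1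
  have hf0 : ∀ z ∈ K, f z ≠ 0 := fun z hz => (hδU hz).2
  have hpow : ContinuousOn (fun z => (‖f z‖ ^ 2) ^ (p / 2 - 1)) K :=
    (hfK.norm.pow 2).rpow_const fun z hz => Or.inl (pow_ne_zero _ (norm_ne_zero_iff.2 (hf0 z hz)))
  obtain ⟨C, hC⟩ := hKc.exists_bound_of_continuousOn
    (((hfK.norm.mul hdK.norm).const_mul 2).mul_const (|p / 2|) |>.mul hpow)
  have hcm : Continuous (circleMap 0 s) := continuous_circleMap 0 s
  have hsb : s ∈ ball s δ := mem_ball_self hδ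
  have hF : ∀ r ∈ ball s δ, Continuous fun θ : ℝ => ‖f (circleMap 0 r θ)‖ ^ p := by
    intro r hr
    have h1 : Continuous fun θ : ℝ => f (circleMap 0 r θ) :=
      hfK.comp_continuous (continuous_circleMap 0 r) (hmem r hr)
    exact h1.norm.rpow_const fun θ => Or.inl (norm_ne_zero_iff.2 (hf0 _ (hmem r hr θ)))
  have key := intervalIntegral.hasDerivAt_integral_of_dominated_loc_of_deriv_le
    (μ := volume) (a := 0) (b := 2 * Real.pi) (bound := fun _ => C)
    (F := fun r θ => ‖f (circleMap 0 r θ)‖ ^ p)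
    (F' := fun r θ => 2 * inner ℝ (f (circleMap 0 r θ)) (deriv f (circleMap 0 r θ)
        * exp (θ * I)) * (p / 2) * (‖f (circleMap 0 r θ)‖ ^ 2) ^ (p / 2 - 1))
    (ball_mem_nhds s hδ)
    (by
      filter_upwards [ball_mem_nhds s hδ] with r hr
      exact (hF r hr).aestronglyMeasurable)
    ((hF s hsb).intervalIntegrable _ _)
    (by
      refine Continuous.aestronglyMeasurable ?_
      have h1 : Continuous fun θ : ℝ => f (circleMap 0 s θ) :=
        hfK.comp_continuous hcm (hmem s hsb)
      have h2 : Continuous fun θ : ℝ => deriv f (circleMap 0 s θ) :=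
        hdK.comp_continuous hcm (hmem s hsb)
      have h3 : Continuous fun θ : ℝ => (‖f (circleMap 0 s θ)‖ ^ 2) ^ (p / 2 - 1) :=
        hpow.comp_continuous hcm (hmem s hsb)
      have h4 : Continuous fun θ : ℝ => exp (θ * I) := by fun_prop
      exact ((continuous_const.mul (h1.inner (h2.mul h4))).mul continuous_const).mul h3)
    (by
      refine Eventually.of_forall fun θ _ r hr => ?_
      refine le_trans ?_ (hC _ (hmem r hr θ))
      have hin : |inner ℝ (f (circleMap 0 r θ)) (deriv f (circleMap 0 r θ) * exp (θ * I))|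
          ≤ ‖f (circleMap 0 r θ)‖ * ‖deriv f (circleMap 0 r θ)‖ := by
        refine (abs_real_inner_le_norm _ _).trans ?_
        rw [norm_mul, norm_exp_ofReal_mul_I, mul_one]
      simp only [Pi.mul_apply, Real.norm_eq_abs, abs_mul, abs_abs, abs_norm]
      gcongr)
    intervalIntegrable_const
    (by
      refine Eventually.of_forall fun θ _ r hr => ?_
      exact hasDerivAt_norm_rpow_circleMap
        (hf _ (ball_subset_closedBall (hδU (hmem r hr θ)).1)) (hf0 _ (hmem r hr θ)))
  exact (key.2.const_smul (2 * Real.pi)⁻¹).differentiableAt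

/-- The exceptional radii are the moduli of the finitely many zeros; the fundamental theorem of
calculus tolerates such a set. -/
theorem exists_countable_differentiableAt {p ρ : ℝ} (hp : 0 < p) {f : ℂ → ℂ}
    (hf : AnalyticOnNhd ℂ f (closedBall 0 ρ)) :
    ∃ S : Set ℝ, S.Countable ∧ ∀ s ∈ Ioo 0 ρ \ S, DifferentiableAt ℝ (integralMeanPow p f) s := by
  by_cases hne : ∃ z ∈ closedBall (0 : ℂ) ρ, f z ≠ 0
  · refine ⟨norm '' {z ∈ closedBall (0 : ℂ) ρ | f z = 0},
      ((finite_zeros_closedBall hf hne).image _).countable, fun s hs => ?_⟩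
    refine differentiableAt_integralMeanPow hf hs.1.1 hs.1.2 fun z hz h0 => hs.2 ?_
    simp only [mem_sphere, dist_zero_right] at hz
    exact ⟨z, ⟨by simpa [hz] using hs.1.2.le, h0⟩, hz⟩
  · push Not at hne
    refine ⟨∅, countable_empty, fun s hs => ?_⟩
    refine (differentiableAt_const (0 : ℝ)).congr_of_eventuallyEq ?_
    filter_upwards [Ioo_mem_nhds hs.1.1 hs.1.2] with t ht
    exact integralMeanPow_eq_zero hp ht.1.le fun z hz => hne z
      (closedBall_subset_closedBall ht.2.le (sphere_subset_closedBall hz))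

theorem deriv_integralMeanPow_nonneg {p ρ : ℝ} (hp : 0 < p) {f : ℂ → ℂ}
    (hf : AnalyticOnNhd ℂ f (closedBall 0 ρ)) {s : ℝ} (hs : s ∈ Ioo 0 ρ) :
    0 ≤ deriv (integralMeanPow p f) s := by
  rw [← derivWithin_of_mem_nhds (Icc_mem_nhds hs.1 hs.2)]
  exact (monotoneOn_integralMeanPow hp hf).derivWithin_nonneg

/-! ### The truncated norm and integration by parts -/

/-- The truncation of `dirichletNormPow` to the disc of radius `ρ`. -/
noncomputable def truncNormPow (α p : ℝ) (f : ℂ → ℂ) (ρ : ℝ) : ENNReal :=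
  ENNReal.ofReal (‖f 0‖ ^ p) +
    ∫⁻ r in Ioo (0 : ℝ) ρ, ENNReal.ofReal (deriv (integralMeanPow p f) r * (1 - r ^ 2) ^ (α - 1))

theorem hasDerivAt_weight (α : ℝ) {s : ℝ} (hs : s ^ 2 < 1) :
    HasDerivAt (fun s : ℝ => (1 - s ^ 2) ^ (α - 1))
      (-(2 * (α - 1) * s * (1 - s ^ 2) ^ (α - 2))) s := by
  have h1 : HasDerivAt (fun s : ℝ => 1 - s ^ 2) (-(2 * s)) s := by
    simpa using (hasDerivAt_pow 2 s).const_sub 1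
  have h2 := h1.rpow_const (p := α - 1) (Or.inl (by linarith : 1 - s ^ 2 ≠ 0))
  convert h2 using 1
  rw [show α - 1 - 1 = α - 2 by ring]
  ring

/-- Integration by parts; the boundary term at `0` cancels against `‖f 0‖ ^ p`, which is the mean at
radius `0`. -/
theorem truncNormPow_eq {α p ρ : ℝ} (hp : 0 < p) (hρ0 : 0 < ρ) (hρ : ρ < 1) {f : ℂ → ℂ}
    (hf : AnalyticOnNhd ℂ f (closedBall 0 ρ)) :
    truncNormPow α p f ρ = ENNReal.ofReal (integralMeanPow p f ρ * (1 - ρ ^ 2) ^ (α - 1)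
      + ∫ s in (0 : ℝ)..ρ, integralMeanPow p f s * (2 * (α - 1) * s * (1 - s ^ 2) ^ (α - 2))) := by
  set M := integralMeanPow p f with hM
  have hMc : ContinuousOn M (Icc 0 ρ) := continuousOn_integralMeanPow hp hf
  have hlt : ∀ s ∈ Icc 0 ρ, 0 < 1 - s ^ 2 := fun s hs => by nlinarith [hs.1, hs.2]
  have hpowc : ∀ β : ℝ, ContinuousOn (fun s : ℝ => (1 - s ^ 2) ^ β) (Icc 0 ρ) := fun β =>
    ContinuousOn.rpow_const (by fun_prop) fun s hs => Or.inl (hlt s hs).ne'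
  have hVc : ContinuousOn (fun s : ℝ => 2 * (α - 1) * s * (1 - s ^ 2) ^ (α - 2)) (Icc 0 ρ) :=
    ContinuousOn.mul (by fun_prop) (hpowc _)
  obtain ⟨S, hS, hdiff⟩ := exists_countable_differentiableAt hp hf
  -- Monotonicity alone makes `deriv M` integrable, so its behaviour at the exceptional radii is
  -- irrelevant.
  have hM' : IntervalIntegrable (deriv M) volume 0 ρ := by
    refine MonotoneOn.intervalIntegrable_deriv ?_
    rw [uIcc_of_le hρ0.le]
    exact monotoneOn_integralMeanPow hp hf
  have hM'W : IntervalIntegrable (fun s => deriv M s * (1 - s ^ 2) ^ (α - 1)) volume 0 ρ :=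
    hM'.mul_continuousOn (by rw [uIcc_of_le hρ0.le]; exact hpowc _)
  have hMV : IntervalIntegrable
      (fun s => M s * (2 * (α - 1) * s * (1 - s ^ 2) ^ (α - 2))) volume 0 ρ :=
    ContinuousOn.intervalIntegrable (by rw [uIcc_of_le hρ0.le]; exact hMc.mul hVc)
  have hftc := integral_eq_of_hasDerivAt_off_countable_of_le
    (fun s => M s * (1 - s ^ 2) ^ (α - 1))
    (fun s => deriv M s * (1 - s ^ 2) ^ (α - 1)
      - M s * (2 * (α - 1) * s * (1 - s ^ 2) ^ (α - 2))) hρ0.le hS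
    (hMc.mul (hpowc _)) (fun s hs => by
      have := (hdiff s hs).hasDerivAt.mul (hasDerivAt_weight α
        (by linarith [hlt s ⟨hs.1.1.le, hs.1.2.le⟩]))
      rw [mul_neg, ← sub_eq_add_neg] at this
      exact this) (hM'W.sub hMV)
  rw [intervalIntegral.integral_sub hM'W hMV] at hftc
  have hM0 : M 0 = ‖f 0‖ ^ p := integralMeanPow_zero p f
  have hnn : ∀ s ∈ Ioo 0 ρ, 0 ≤ deriv M s * (1 - s ^ 2) ^ (α - 1) := fun s hs =>
    mul_nonneg (deriv_integralMeanPow_nonneg hp hf hs)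
      (Real.rpow_nonneg (hlt s ⟨hs.1.le, hs.2.le⟩).le _)
  have hint : ∫⁻ r in Ioo (0 : ℝ) ρ, ENNReal.ofReal (deriv M r * (1 - r ^ 2) ^ (α - 1))
      = ENNReal.ofReal (∫ s in (0 : ℝ)..ρ, deriv M s * (1 - s ^ 2) ^ (α - 1)) := by
    rw [intervalIntegral.integral_of_le hρ0.le, integral_Ioc_eq_integral_Ioo,
      ofReal_integral_eq_lintegral_ofReal]
    · exact ((intervalIntegrable_iff_integrableOn_Ioo_of_le hρ0.le).1 hM'W)
    · exact (ae_restrict_iff' measurableSet_Ioo).2 (Eventually.of_forall hnn)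
  rw [truncNormPow, hint, ← ENNReal.ofReal_add (by positivity)
    (by
      rw [intervalIntegral.integral_of_le hρ0.le, integral_Ioc_eq_integral_Ioo]
      exact setIntegral_nonneg measurableSet_Ioo hnn)]
  congr 1
  simp [hM0] at hftc
  linarith

theorem truncNormPow_mono {α p ρ ρ' : ℝ} (h : ρ ≤ ρ') (f : ℂ → ℂ) :
    truncNormPow α p f ρ ≤ truncNormPow α p f ρ' :=
  add_le_add le_rfl (lintegral_mono_set (Ioo_subset_Ioo_right h))

theorem truncNormPow_one (α p : ℝ) (f : ℂ → ℂ) :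
    truncNormPow α p f 1 = dirichletNormPow α p f := rfl

/-! ### Binomial coefficients and coefficient weights -/

/-- The binomial coefficients of `(1 - x) ^ (-α)`. -/
noncomputable def binomCoeff (α : ℝ) (n : ℕ) : ℝ := Ring.multichoose α n

theorem binomCoeff_zero (α : ℝ) : binomCoeff α 0 = 1 := by simp [binomCoeff]

theorem binomCoeff_succ (α : ℝ) (n : ℕ) :
    (n + 1) * binomCoeff α (n + 1) = (α + n) * binomCoeff α n := by
  have h1 := Ring.factorial_nsmul_multichoose_eq_ascPochhammer α n
  have h2 := Ring.factorial_nsmul_multichoose_eq_ascPochhammer α (n + 1)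
  rw [ascPochhammer_succ_right, Polynomial.smeval_mul, ← h1] at h2
  have hn : (n.factorial : ℝ) ≠ 0 := by exact_mod_cast n.factorial_ne_zero
  simp [Nat.factorial_succ, Polynomial.smeval_add, Polynomial.smeval_X, Polynomial.smeval_natCast] at h2
  unfold binomCoeff
  refine mul_left_cancel₀ hn ?_
  linear_combination h2

theorem binomCoeff_pos {α : ℝ} (hα : 0 < α) (n : ℕ) : 0 < binomCoeff α n := by
  induction n with
  | zero => simp [binomCoeff_zero]
  | succ n ih =>
    have := binomCoeff_succ α n
    have h : 0 < (α + n) * binomCoeff α n := by positivity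
    rw [← this] at h
    exact pos_of_mul_pos_right h (by positivity)

theorem hasSum_binomCoeff (α : ℝ) {x : ℂ} (hx : ‖x‖ < 1) :
    HasSum (fun n => (binomCoeff α n : ℂ) * x ^ n) ((1 - x) ^ (-α : ℂ)) := by
  have h := (one_div_one_sub_cpow_hasFPowerSeriesOnBall_zero (α : ℂ)).hasSum (y := x)
    (by simpa [enorm_eq_nnnorm, ← NNReal.coe_lt_coe] using hx)
  have h2 : (1 : ℂ) / (1 - x) ^ (α : ℂ) = (1 - x) ^ (-α : ℂ) := by rw [cpow_neg, one_div]
  simp only [zero_add, h2] at h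
  refine h.congr_fun fun n => ?_
  simp [binomCoeff, Ring.multichoose_eq, ofReal_choose, mul_comm]

theorem hasSum_binomCoeff_real (α : ℝ) {t : ℝ} (ht0 : 0 ≤ t) (ht : t < 1) :
    HasSum (fun n => binomCoeff α n * t ^ n) ((1 - t) ^ (-α)) := by
  have h := hasSum_binomCoeff α (x := (t : ℂ)) (by simpa [abs_of_nonneg ht0] using ht)
  have h2 : (1 - (t : ℂ)) ^ (-α : ℂ) = (((1 - t) ^ (-α) : ℝ) : ℂ) := by
    rw [ofReal_cpow (by linarith)]; simp
  rw [h2] at h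
  exact_mod_cast h

/-- The weight of the `n`-th Taylor coefficient in the truncated norm for `p = 2`. -/
noncomputable def coeffWeight (α : ℝ) (ρ : ℝ) (n : ℕ) : ENNReal :=
  (if n = 0 then 1 else 0) +
    ∫⁻ s in Ioo (0 : ℝ) ρ, ENNReal.ofReal (2 * n * s ^ (2 * n - 1) * (1 - s ^ 2) ^ (α - 1))

/-- For `α < 1` the weight is unbounded at `1`; it is integrable as a nonnegative derivative of a
continuous function, up to the factor `α`. -/
theorem integrableOn_weight {α : ℝ} (hα : 0 < α) :
    IntegrableOn (fun s : ℝ => 2 * s * (1 - s ^ 2) ^ (α - 1)) (Ioc 0 1) := by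
  have h := intervalIntegral.integrableOn_deriv_of_nonneg (a := 0) (b := 1)
    (g := fun s : ℝ => -((1 - s ^ 2) ^ α)) (g' := fun s => α * (2 * s * (1 - s ^ 2) ^ (α - 1)))
    (ContinuousOn.neg (ContinuousOn.rpow_const (by fun_prop) fun _ _ => Or.inr hα.le))
    (fun s hs => by
      have hs1 : 1 - s ^ 2 ≠ 0 := by nlinarith [hs.1, hs.2]
      have h1 : HasDerivAt (fun s : ℝ => 1 - s ^ 2) (-(2 * s)) s := by
        simpa using (hasDerivAt_pow 2 s).const_sub 1
      have h2 := (h1.rpow_const (p := α) (Or.inl hs1)).neg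
      refine h2.congr_deriv ?_
      ring)
    (fun s hs => by
      have hs1 : 0 < 1 - s ^ 2 := by nlinarith [hs.1, hs.2]
      have := hs.1
      positivity)
  have h2 := h.const_mul α⁻¹
  refine h2.congr (Eventually.of_forall fun s => ?_)
  simp only
  field_simp

theorem integrableOn_pow_weight {α : ℝ} (hα : 0 < α) (n : ℕ) :
    IntegrableOn (fun s : ℝ => 2 * s ^ (2 * n + 1) * (1 - s ^ 2) ^ (α - 1)) (Ioc 0 1) := by
  have h := (integrableOn_weight hα).bdd_mul (f := fun s : ℝ => s ^ (2 * n)) (c := 1)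
    (by fun_prop) (by
      refine (ae_restrict_iff' measurableSet_Ioc).2 (Eventually.of_forall fun s hs => ?_)
      rw [norm_pow, Real.norm_of_nonneg hs.1.le]
      exact pow_le_one₀ hs.1.le hs.2)
  refine h.congr (Eventually.of_forall fun s => ?_)
  simp only
  ring

/-- A Beta integral. The function `s^(2(n+1)) (1-s²)^α` vanishes at both endpoints, and integrating
its derivative gives the recursion of `binomCoeff_succ`. -/
theorem integral_pow_weight {α : ℝ} (hα : 0 < α) (n : ℕ) :
    (n + 1) * ∫ s in Ioc (0 : ℝ) 1, 2 * s ^ (2 * n + 1) * (1 - s ^ 2) ^ (α - 1)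
      = (binomCoeff α (n + 1))⁻¹ := by
  induction n with
  | zero =>
    have hftc := integral_eq_of_hasDerivAt_off_countable_of_le
      (fun s : ℝ => -((1 - s ^ 2) ^ α)) (fun s => α * (2 * s ^ 1 * (1 - s ^ 2) ^ (α - 1)))
      zero_le_one countable_empty
      (ContinuousOn.neg (ContinuousOn.rpow_const (by fun_prop) fun _ _ => Or.inr hα.le))
      (fun s hs => by
        have hs1 : 1 - s ^ 2 ≠ 0 := by nlinarith [hs.1.1, hs.1.2]
        have h1 : HasDerivAt (fun s : ℝ => 1 - s ^ 2) (-(2 * s)) s := by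
          simpa using (hasDerivAt_pow 2 s).const_sub 1
        have h2 := (h1.rpow_const (p := α) (Or.inl hs1)).neg
        refine h2.congr_deriv ?_
        ring)
      (by
        rw [intervalIntegrable_iff_integrableOn_Ioc_of_le zero_le_one]
        exact (integrableOn_pow_weight hα 0).const_mul α)
    rw [intervalIntegral.integral_of_le zero_le_one, integral_const_mul] at hftc
    have hb := binomCoeff_succ α 0
    simp [binomCoeff_zero, Real.zero_rpow hα.ne'] at hftc hb
    simp [hb]
    field_simp
    linarith
  | succ n ih =>
    have hi1 := integrableOn_pow_weight hα n
    have hi2 := integrableOn_pow_weight hα (n + 1)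
    have hftc := integral_eq_of_hasDerivAt_off_countable_of_le
      (fun s : ℝ => s ^ (2 * (n + 1)) * (1 - s ^ 2) ^ α)
      (fun s => (n + 1) * (2 * s ^ (2 * n + 1) * (1 - s ^ 2) ^ (α - 1))
        - (n + 1 + α) * (2 * s ^ (2 * (n + 1) + 1) * (1 - s ^ 2) ^ (α - 1)))
      zero_le_one countable_empty
      (ContinuousOn.mul (by fun_prop)
        (ContinuousOn.rpow_const (by fun_prop) fun _ _ => Or.inr hα.le))
      (fun s hs => by
        have hs1 : 0 < 1 - s ^ 2 := by nlinarith [hs.1.1, hs.1.2]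
        have h1 : HasDerivAt (fun s : ℝ => 1 - s ^ 2) (-(2 * s)) s := by
          simpa using (hasDerivAt_pow 2 s).const_sub 1
        have h2 := (hasDerivAt_pow (2 * (n + 1)) s).mul (h1.rpow_const (p := α) (Or.inl hs1.ne'))
        refine h2.congr_deriv ?_
        have h3 : (1 - s ^ 2) ^ α = (1 - s ^ 2) ^ (α - 1) * (1 - s ^ 2) := by
          rw [← Real.rpow_add_one hs1.ne']; simp
        rw [h3, show 2 * (n + 1) - 1 = 2 * n + 1 by omega]
        push_cast
        ring)
      (by
        rw [intervalIntegrable_iff_integrableOn_Ioc_of_le zero_le_one]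
        exact (hi1.const_mul _).sub (hi2.const_mul _))
    rw [intervalIntegral.integral_of_le zero_le_one, integral_sub (hi1.const_mul _)
      (hi2.const_mul _), integral_const_mul, integral_const_mul, ih] at hftc
    have hb := binomCoeff_succ α (n + 1)
    have hp1 := binomCoeff_pos hα (n + 1)
    have hp2 := binomCoeff_pos hα (n + 1 + 1)
    simp [Real.zero_rpow hα.ne'] at hftc
    push_cast at hb ⊢
    set J := ∫ s in Ioc (0 : ℝ) 1, 2 * s ^ (2 * (n + 1) + 1) * (1 - s ^ 2) ^ (α - 1)
    have h4 : (n + 1 + α) * J = (binomCoeff α (n + 1))⁻¹ := by linarith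
    refine eq_inv_of_mul_eq_one_left ?_
    calc ((n : ℝ) + 1 + 1) * J * binomCoeff α (n + 1 + 1)
        = J * ((n + 1 + 1) * binomCoeff α (n + 1 + 1)) := by ring
      _ = ((n + 1 + α) * J) * binomCoeff α (n + 1) := by rw [hb]; ring
      _ = 1 := by rw [h4, inv_mul_cancel₀ hp1.ne']

theorem coeffWeight_one {α : ℝ} (hα : 0 < α) (n : ℕ) :
    coeffWeight α 1 n = ENNReal.ofReal (binomCoeff α n)⁻¹ := by
  cases n with
  | zero => simp [coeffWeight, binomCoeff_zero]
  | succ n =>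
    rw [← integral_pow_weight hα n, ← integral_const_mul, integral_Ioc_eq_integral_Ioo,
      ofReal_integral_eq_lintegral_ofReal]
    · simp only [coeffWeight, Nat.add_eq_zero_iff, one_ne_zero, and_false, if_false, zero_add]
      refine lintegral_congr fun s => ?_
      rw [show 2 * (n + 1) - 1 = 2 * n + 1 by omega]
      congr 1
      push_cast
      ring
    · exact ((integrableOn_pow_weight hα n).mono_set Ioo_subset_Ioc_self).const_mul _
    · refine (ae_restrict_iff' measurableSet_Ioo).2 (Eventually.of_forall fun s hs => ?_)
      have hs1 : 0 < 1 - s ^ 2 := by nlinarith [hs.1, hs.2]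
      have := hs.1
      simp only [Pi.zero_apply]
      positivity

theorem coeffWeight_mono {α ρ ρ' : ℝ} (h : ρ ≤ ρ') (n : ℕ) :
    coeffWeight α ρ n ≤ coeffWeight α ρ' n :=
  add_le_add le_rfl (lintegral_mono_set (Ioo_subset_Ioo_right h))

theorem coeffWeight_ne_top {α ρ : ℝ} (hα : 0 < α) (h : ρ ≤ 1) (n : ℕ) :
    coeffWeight α ρ n ≠ ⊤ :=
  ((coeffWeight_mono h n).trans_lt (by rw [coeffWeight_one hα]; exact ENNReal.ofReal_lt_top)).ne

/-- For `α ≤ 1` the factor `(1-s²)^(α-1)` is at least `1`, and without it the integral is `ρ^(2n)`.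
This bound makes the truncated kernel converge for `‖w‖ < ρ`. -/
theorem pow_le_coeffWeight {α ρ : ℝ} (hα1 : α ≤ 1) (hρ0 : 0 < ρ) (hρ : ρ ≤ 1) (n : ℕ) :
    ENNReal.ofReal (ρ ^ (2 * n)) ≤ coeffWeight α ρ n := by
  cases n with
  | zero => simp [coeffWeight]
  | succ n =>
    have h1 : ENNReal.ofReal (ρ ^ (2 * (n + 1)))
        = ∫⁻ s in Ioo (0 : ℝ) ρ, ENNReal.ofReal (2 * (n + 1 : ℕ) * s ^ (2 * (n + 1) - 1)) := by
      rw [← ofReal_integral_eq_lintegral_ofReal, ← integral_Ioc_eq_integral_Ioo,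
        ← intervalIntegral.integral_of_le hρ0.le, intervalIntegral.integral_const_mul,
        integral_pow, show 2 * (n + 1) - 1 = 2 * n + 1 by omega]
      · congr 1
        push_cast
        have : (2 * (n : ℝ) + 1 + 1) ≠ 0 := by positivity
        field_simp
        simp
        ring
      · exact (Continuous.integrableOn_Icc (by fun_prop)).mono_set Ioo_subset_Icc_self
      · refine (ae_restrict_iff' measurableSet_Ioo).2 (Eventually.of_forall fun s hs => ?_)
        have := hs.1
        simp only [Pi.zero_apply]
        positivity
    rw [h1]
    refine le_add_left (setLIntegral_mono' measurableSet_Ioo fun s hs => ?_)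
    have hs0 := hs.1
    have hs1 : 0 < 1 - s ^ 2 := by nlinarith [hs.1, hs.2]
    refine ENNReal.ofReal_le_ofReal (le_mul_of_one_le_right (by positivity) ?_)
    exact Real.one_le_rpow_of_pos_of_le_one_of_nonpos hs1 (by nlinarith) (by linarith)

/-- Exhaustion of the unit interval. -/
theorem tendsto_lintegral_Ioo (F : ℝ → ENNReal) :
    Tendsto (fun k : ℕ => ∫⁻ s in Ioo (0 : ℝ) (1 - 1 / ((k : ℝ) + 2)), F s) atTop
      (𝓝 (∫⁻ s in Ioo (0 : ℝ) 1, F s)) := by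
  have hmono : Monotone fun k : ℕ => Ioo (0 : ℝ) (1 - 1 / ((k : ℝ) + 2)) := by
    intro k l hkl
    refine Ioo_subset_Ioo_right ?_
    have : (k : ℝ) ≤ l := by exact_mod_cast hkl
    gcongr
  have hU : ⋃ k : ℕ, Ioo (0 : ℝ) (1 - 1 / ((k : ℝ) + 2)) = Ioo 0 1 := by
    ext s
    simp only [mem_iUnion, mem_Ioo]
    constructor
    · rintro ⟨k, h0, h1⟩
      have : 0 < 1 / ((k : ℝ) + 2) := by positivity
      exact ⟨h0, by linarith⟩
    · rintro ⟨h0, h1⟩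
      obtain ⟨k, hk⟩ := exists_nat_one_div_lt (sub_pos.2 h1)
      refine ⟨k, h0, ?_⟩
      have : 1 / ((k : ℝ) + 2) ≤ 1 / ((k : ℝ) + 1) := by gcongr; norm_num
      linarith
  rw [← hU, setLIntegral_iUnion_of_directed _ hmono.directed_le]
  exact tendsto_atTop_iSup fun k l hkl => lintegral_mono_set (hmono hkl)

theorem tendsto_coeffWeight {α : ℝ} (n : ℕ) :
    Tendsto (fun k : ℕ => coeffWeight α (1 - 1 / ((k : ℝ) + 2)) n) atTop
      (𝓝 (coeffWeight α 1 n)) :=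
  (tendsto_lintegral_Ioo _).const_add _

/-! ### The truncated norm as a weighted sum of squares -/

/-- The truncated norm of a zero-free function in terms of Taylor coefficients. -/
theorem truncNormPow_eq_tsum {α p ρ : ℝ} (hρ : ρ ≤ 1) (hρ0 : 0 < ρ) {f h : ℂ → ℂ}
    (hh : DifferentiableOn ℂ h (ball 0 ρ))
    (hfh : ∀ z ∈ ball (0 : ℂ) ρ, ‖f z‖ ^ p = ‖h z‖ ^ 2) :
    truncNormPow α p f ρ
      = ∑' n, ENNReal.ofReal (‖taylorCoeff h n‖ ^ 2) * coeffWeight α ρ n := by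
  set A : ℕ → ℝ := fun n => ‖taylorCoeff h n‖ ^ 2 with hA
  have hderiv : ∀ s ∈ Ioo 0 ρ, HasSum (fun n : ℕ => A n * (2 * n * s ^ (2 * n - 1)))
      (deriv (integralMeanPow p f) s) := by
    intro s hs
    -- Boundedness of the terms at `u` yields the ratio `(t/u)²` on `(0, t)`, a geometric decay that
    -- absorbs the factor `n` from differentiation.
    obtain ⟨t, hst, htρ⟩ := exists_between hs.2
    obtain ⟨u, htu, huρ⟩ := exists_between htρ
    have ht0 : 0 < t := hs.1.trans hst
    have hu0 : 0 < u := ht0.trans htu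
    obtain ⟨B, hB⟩ : ∃ B, ∀ n, A n * u ^ (2 * n) ≤ B :=
      ⟨_, fun n => (summable_norm_sq_taylorCoeff hh hu0.le huρ).le_tsum n
        (fun j _ => by positivity)⟩
    have hq0 : 0 ≤ (t / u) ^ 2 := by positivity
    have hq1 : (t / u) ^ 2 < 1 := by
      rw [sq_lt_one_iff₀ (by positivity)]
      exact (div_lt_one hu0).2 htu
    have hgeo : Summable fun n : ℕ => (2 * B / t) * ((n : ℝ) ^ 1 * ((t / u) ^ 2) ^ n) := by
      refine Summable.mul_left _ ?_
      exact summable_pow_mul_geometric_of_norm_lt_one 1 (by rwa [Real.norm_of_nonneg hq0])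
    have hbound : ∀ (n : ℕ), ∀ y ∈ Ioo 0 t, ‖A n * (2 * n * y ^ (2 * n - 1))‖
        ≤ (2 * B / t) * ((n : ℝ) ^ 1 * ((t / u) ^ 2) ^ n) := by
      intro n y hy
      have hy0 := hy.1
      rw [Real.norm_of_nonneg (by positivity)]
      -- At `n = 0` the truncated exponent `2 * n - 1` is harmless, since the factor `n` kills the
      -- term.
      rcases Nat.eq_zero_or_pos n with rfl | hn
      · simp
      have h1 : y ^ (2 * n - 1) ≤ t ^ (2 * n - 1) := pow_le_pow_left₀ hy.1.le hy.2.le _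
      have h2 : t ^ (2 * n) = t ^ (2 * n - 1) * t := by
        rw [← pow_succ]; congr 1; omega
      calc A n * (2 * n * y ^ (2 * n - 1)) ≤ A n * (2 * n * t ^ (2 * n - 1)) := by
            gcongr
        _ = (A n * u ^ (2 * n)) * (2 * n * (t ^ (2 * n) / u ^ (2 * n)) / t) := by
            rw [h2]; field_simp
        _ ≤ B * (2 * n * (t ^ (2 * n) / u ^ (2 * n)) / t) := by
            gcongr
            exact hB n
        _ = _ := by rw [← div_pow, ← pow_mul]; ring
    have hsm := summable_norm_sq_taylorCoeff hh hs.1.le hs.2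
    have hd := hasDerivAt_tsum_of_isPreconnected (g := fun n y => A n * y ^ (2 * n))
      (g' := fun n y => A n * (2 * n * y ^ (2 * n - 1))) hgeo isOpen_Ioo isPreconnected_Ioo
      (fun n y _ => by
        have := (hasDerivAt_pow (2 * n) y).const_mul (A n)
        push_cast at this
        exact this)
      hbound ⟨hs.1, hst⟩ hsm ⟨hs.1, hst⟩
    have hd2 : HasDerivAt (integralMeanPow p f) (∑' n : ℕ, A n * (2 * n * s ^ (2 * n - 1))) s := by
      refine hd.congr_of_eventuallyEq ?_
      filter_upwards [Ioo_mem_nhds hs.1 hs.2] with y hy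
      exact integralMeanPow_eq_tsum hh hfh hy.1.le hy.2
    rw [hd2.deriv]
    exact (Summable.of_norm_bounded hgeo fun n => hbound n s ⟨hs.1, hst⟩).hasSum
  have hint : ∫⁻ r in Ioo (0 : ℝ) ρ,
        ENNReal.ofReal (deriv (integralMeanPow p f) r * (1 - r ^ 2) ^ (α - 1))
      = ∑' n : ℕ, ENNReal.ofReal (A n) * ∫⁻ s in Ioo (0 : ℝ) ρ,
          ENNReal.ofReal (2 * n * s ^ (2 * n - 1) * (1 - s ^ 2) ^ (α - 1)) := by
    have h1 : ∀ r ∈ Ioo (0 : ℝ) ρ,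
        ENNReal.ofReal (deriv (integralMeanPow p f) r * (1 - r ^ 2) ^ (α - 1))
        = ∑' n : ℕ, ENNReal.ofReal (A n) *
          ENNReal.ofReal (2 * n * r ^ (2 * n - 1) * (1 - r ^ 2) ^ (α - 1)) := by
      intro r hr
      have hr0 := hr.1
      have hr1 : 0 ≤ 1 - r ^ 2 := by nlinarith [hr.1, hr.2]
      have h2 := (hderiv r hr).mul_right ((1 - r ^ 2) ^ (α - 1))
      rw [← h2.tsum_eq, ENNReal.ofReal_tsum_of_nonneg (fun n => by positivity) h2.summable]
      refine tsum_congr fun n => ?_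
      rw [← ENNReal.ofReal_mul (by positivity)]
      congr 1
      ring
    rw [setLIntegral_congr_fun measurableSet_Ioo h1, lintegral_tsum]
    · refine tsum_congr fun n => ?_
      rw [lintegral_const_mul]
      fun_prop
    · intro n
      fun_prop
  have h00 : ‖f 0‖ ^ p = A 0 := by
    rw [hfh 0 (mem_ball_self hρ0)]
    simp [hA, taylorCoeff]
  rw [truncNormPow, hint, h00]
  simp only [coeffWeight, mul_add]
  rw [ENNReal.tsum_add]
  congr 1
  rw [tsum_eq_single 0 (fun n hn => by simp [hn])]
  simp [hA]

/-! ### Weighted Cauchy–Schwarz inequality with its equality case -/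

theorem norm_sq_sub_div (a lam w : ℂ) {c : ℝ} (hc : 0 < c) (n : ℕ) :
    c * ‖a - lam * conj w ^ n / c‖ ^ 2
      = c * ‖a‖ ^ 2 - 2 * (conj lam * (a * w ^ n)).re + ‖lam‖ ^ 2 * (‖w‖ ^ (2 * n) / c) := by
  have h2 : ‖lam * conj w ^ n / c‖ ^ 2 = ‖lam‖ ^ 2 * ‖w‖ ^ (2 * n) / c ^ 2 := by
    simp [div_pow, mul_pow, ← pow_mul, mul_comm]
  have h3 : (a * conj (lam * conj w ^ n / c)).re = (conj lam * (a * w ^ n)).re / c := by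
    rw [← div_ofReal_re]
    congr 1
    simp
    ring
  rw [← normSq_eq_norm_sq, normSq_sub, h3, normSq_eq_norm_sq, normSq_eq_norm_sq, h2]
  field_simp
  ring

/-- Completing the square: the choice `H / K` of the multiplier makes the cross term and the kernel
term combine to `-‖H‖²/K`. Nonnegativity of the sum is Cauchy–Schwarz, and its vanishing is the
equality case. -/
theorem hasSum_weighted_dist {a : ℕ → ℂ} {c : ℕ → ℝ} (hc : ∀ n, 0 < c n) {w H : ℂ} {K : ℝ}
    (hH : HasSum (fun n => a n * w ^ n) H) (hS : Summable fun n => c n * ‖a n‖ ^ 2)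
    (hK : HasSum (fun n => ‖w‖ ^ (2 * n) / c n) K) (hK0 : 0 < K) :
    HasSum (fun n => c n * ‖a n - H / K * conj w ^ n / c n‖ ^ 2)
      (∑' n, c n * ‖a n‖ ^ 2 - ‖H‖ ^ 2 / K) := by
  have h1 := (hasSum_re (hH.mul_left (conj (H / K)))).mul_left 2
  have h2 := (hS.hasSum.sub h1).add (hK.mul_left (‖H / K‖ ^ 2))
  have h3 : ∑' n, c n * ‖a n‖ ^ 2 - 2 * (conj (H / K) * H).re + ‖H / K‖ ^ 2 * K
      = ∑' n, c n * ‖a n‖ ^ 2 - ‖H‖ ^ 2 / K := by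
    have h4 : conj (H / K) * H = ((‖H‖ ^ 2 / K : ℝ) : ℂ) := by
      rw [map_div₀, conj_ofReal, div_mul_eq_mul_div, mul_comm, mul_conj, normSq_eq_norm_sq]
      push_cast
      rfl
    rw [h4, ofReal_re, norm_div, norm_real, Real.norm_of_nonneg hK0.le]
    field_simp
    ring
  rw [h3] at h2
  exact h2.congr_fun fun n => norm_sq_sub_div _ _ _ (hc n) n

theorem summable_of_tsum_ofReal_ne_top {a : ℕ → ℂ} {c : ℕ → ℝ} (hc : ∀ n, 0 < c n)
    (h : ∑' n, ENNReal.ofReal (‖a n‖ ^ 2) * ENNReal.ofReal (c n) ≠ ⊤) :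
    (Summable fun n => c n * ‖a n‖ ^ 2) ∧
      ∑' n, ENNReal.ofReal (‖a n‖ ^ 2) * ENNReal.ofReal (c n)
        = ENNReal.ofReal (∑' n, c n * ‖a n‖ ^ 2) := by
  have h1 : ∀ n, ENNReal.ofReal (‖a n‖ ^ 2) * ENNReal.ofReal (c n)
      = ENNReal.ofReal (c n * ‖a n‖ ^ 2) := fun n => by
    rw [← ENNReal.ofReal_mul (by positivity), mul_comm]
  have h0 : ∀ n, 0 ≤ c n * ‖a n‖ ^ 2 := fun n => mul_nonneg (hc n).le (by positivity)
  simp only [h1] at h ⊢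
  have hs : Summable fun n => c n * ‖a n‖ ^ 2 := by
    have := ENNReal.summable_toReal h
    refine this.congr fun n => ENNReal.toReal_ofReal (h0 n)
  exact ⟨hs, (ENNReal.ofReal_tsum_of_nonneg h0 hs).symm⟩

theorem ofReal_le_tsum_weighted {a : ℕ → ℂ} {c : ℕ → ℝ} (hc : ∀ n, 0 < c n) {w H : ℂ} {K : ℝ}
    (hH : HasSum (fun n => a n * w ^ n) H)
    (hK : HasSum (fun n => ‖w‖ ^ (2 * n) / c n) K) (hK0 : 0 < K) :
    ENNReal.ofReal (‖H‖ ^ 2 / K)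
      ≤ ∑' n, ENNReal.ofReal (‖a n‖ ^ 2) * ENNReal.ofReal (c n) := by
  by_cases h : ∑' n, ENNReal.ofReal (‖a n‖ ^ 2) * ENNReal.ofReal (c n) = ⊤
  · rw [h]; exact le_top
  obtain ⟨hs, heq⟩ := summable_of_tsum_ofReal_ne_top hc h
  rw [heq]
  refine ENNReal.ofReal_le_ofReal (sub_nonneg.1 ?_)
  exact (hasSum_weighted_dist hc hH hs hK hK0).nonneg fun n =>
    mul_nonneg (hc n).le (by positivity)

theorem eq_of_ofReal_eq_tsum_weighted {a : ℕ → ℂ} {c : ℕ → ℝ} (hc : ∀ n, 0 < c n) {w H : ℂ}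
    {K : ℝ} (hH : HasSum (fun n => a n * w ^ n) H)
    (hK : HasSum (fun n => ‖w‖ ^ (2 * n) / c n) K) (hK0 : 0 < K)
    (heq : ENNReal.ofReal (‖H‖ ^ 2 / K)
      = ∑' n, ENNReal.ofReal (‖a n‖ ^ 2) * ENNReal.ofReal (c n)) (n : ℕ) :
    a n = H / K * conj w ^ n / c n := by
  obtain ⟨hs, heq'⟩ := summable_of_tsum_ofReal_ne_top (a := a) hc
    (heq ▸ ENNReal.ofReal_ne_top)
  have h0 : ∀ n, 0 ≤ c n * ‖a n‖ ^ 2 := fun n => mul_nonneg (hc n).le (by positivity)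
  rw [heq', ENNReal.ofReal_eq_ofReal_iff (by positivity) (tsum_nonneg h0)] at heq
  have h1 := hasSum_weighted_dist hc hH hs hK hK0
  rw [← heq, sub_self] at h1
  have h2 := (hasSum_zero_iff_of_nonneg fun n =>
    mul_nonneg (hc n).le (by positivity)).1 h1
  have h3 := congrFun h2 n
  simp only [Pi.zero_apply, mul_eq_zero, (hc n).ne', false_or, pow_eq_zero_iff two_ne_zero,
    norm_eq_zero] at h3
  exact sub_eq_zero.1 h3

theorem coeffWeight_toReal_pos {α ρ : ℝ} (hα : 0 < α) (hα1 : α ≤ 1) (hρ0 : 0 < ρ) (hρ : ρ ≤ 1)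
    (n : ℕ) : 0 < (coeffWeight α ρ n).toReal ∧ ρ ^ (2 * n) ≤ (coeffWeight α ρ n).toReal := by
  have h1 := (ENNReal.ofReal_le_iff_le_toReal (coeffWeight_ne_top hα hρ n)).1
    (pow_le_coeffWeight hα1 hρ0 hρ n)
  exact ⟨(by positivity : 0 < ρ ^ (2 * n)).trans_le h1, h1⟩

/-! ### The truncated kernel and its limit -/

/-- The reproducing kernel on the diagonal for the truncated norm with `p = 2`. -/
noncomputable def truncKernel (α ρ : ℝ) (w : ℂ) : ℝ :=
  ∑' n : ℕ, ‖w‖ ^ (2 * n) / (coeffWeight α ρ n).toReal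

theorem pow_div_coeffWeight_le {α ρ ρ' : ℝ} (hα : 0 < α) (hα1 : α ≤ 1) (hρ0 : 0 < ρ')
    (hρ' : ρ' ≤ ρ) (hρ : ρ ≤ 1) (w : ℂ) (n : ℕ) :
    ‖w‖ ^ (2 * n) / (coeffWeight α ρ n).toReal ≤ ((‖w‖ / ρ') ^ 2) ^ n := by
  have h := (coeffWeight_toReal_pos hα hα1 (hρ0.trans_le hρ') hρ n).2
  rw [← pow_mul, div_pow]
  refine div_le_div_of_nonneg_left (by positivity) (by positivity) (le_trans ?_ h)
  gcongr

theorem summable_sq_div_pow {ρ : ℝ} {w : ℂ} (hw : ‖w‖ < ρ) :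
    Summable fun n : ℕ => ((‖w‖ / ρ) ^ 2) ^ n := by
  have hρ : 0 < ρ := (norm_nonneg w).trans_lt hw
  refine summable_geometric_of_lt_one (by positivity) ?_
  rw [sq_lt_one_iff₀ (by positivity)]
  exact (div_lt_one hρ).2 hw

theorem hasSum_truncKernel {α ρ : ℝ} (hα : 0 < α) (hα1 : α ≤ 1) (hρ : ρ ≤ 1) {w : ℂ}
    (hw : ‖w‖ < ρ) :
    HasSum (fun n : ℕ => ‖w‖ ^ (2 * n) / (coeffWeight α ρ n).toReal) (truncKernel α ρ w) :=
  (Summable.of_nonneg_of_le (fun n => by positivity)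
    (pow_div_coeffWeight_le hα hα1 ((norm_nonneg w).trans_lt hw) le_rfl hρ w)
    (summable_sq_div_pow hw)).hasSum

theorem truncKernel_pos {α ρ : ℝ} (hα : 0 < α) (hα1 : α ≤ 1) (hρ : ρ ≤ 1) {w : ℂ}
    (hw : ‖w‖ < ρ) : 0 < truncKernel α ρ w := by
  have hρ0 : 0 < ρ := (norm_nonneg w).trans_lt hw
  have h := (hasSum_truncKernel hα hα1 hρ hw).summable.le_tsum 0 fun n _ => by positivity
  refine lt_of_lt_of_le ?_ h
  simpa using (coeffWeight_toReal_pos hα hα1 hρ0 hρ 0).1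

theorem hasSum_kernel_diag (α : ℝ) {w : ℂ} (hw : ‖w‖ < 1) :
    HasSum (fun n => ‖w‖ ^ (2 * n) / (binomCoeff α n)⁻¹) ((1 - ‖w‖ ^ 2) ^ (-α)) := by
  have h := hasSum_binomCoeff_real α (t := ‖w‖ ^ 2) (by positivity)
    ((sq_lt_one_iff₀ (norm_nonneg w)).2 hw)
  refine h.congr_fun fun n => ?_
  rw [div_inv_eq_mul, ← pow_mul, mul_comm]

theorem tendsto_one_sub_one_div : Tendsto (fun k : ℕ => 1 - 1 / ((k : ℝ) + 2)) atTop (𝓝 1) := by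
  have := (tendsto_one_div_add_atTop_nhds_zero_nat (𝕜 := ℝ)).comp (tendsto_add_atTop_nat 1)
  have h2 := this.const_sub 1
  simp only [sub_zero] at h2
  refine h2.congr fun k => ?_
  simp
  ring

/-- Dominated convergence: the weights tend to the inverse binomial coefficients, and for all radii
beyond a fixed `ρ'` between `‖w‖` and `1` the terms share one geometric majorant. -/
theorem tendsto_truncKernel {α : ℝ} (hα : 0 < α) (hα1 : α ≤ 1) {w : ℂ} (hw : ‖w‖ < 1) :
    Tendsto (fun k : ℕ => truncKernel α (1 - 1 / ((k : ℝ) + 2)) w) atTop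
      (𝓝 ((1 - ‖w‖ ^ 2) ^ (-α))) := by
  rw [← (hasSum_kernel_diag α hw).tsum_eq]
  obtain ⟨ρ', hwρ, hρ1⟩ := exists_between hw
  refine tendsto_tsum_of_dominated_convergence (summable_sq_div_pow hwρ) ?_ ?_
  · intro n
    have h1 := (ENNReal.tendsto_toReal (coeffWeight_ne_top hα le_rfl n)).comp
      (tendsto_coeffWeight (α := α) n)
    rw [coeffWeight_one hα, ENNReal.toReal_ofReal (by have := binomCoeff_pos hα n; positivity)] at h1
    exact tendsto_const_nhds.div h1 (inv_ne_zero (binomCoeff_pos hα n).ne')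
  · filter_upwards [tendsto_one_sub_one_div.eventually (eventually_ge_nhds hρ1)] with k hk n
    rw [Real.norm_of_nonneg (by positivity)]
    refine pow_div_coeffWeight_le hα hα1 ((norm_nonneg w).trans_lt hwρ) hk ?_ w n
    have : 0 < 1 / ((k : ℝ) + 2) := by positivity
    linarith

/-! ### The case `α ≤ 1` -/

theorem ofReal_le_truncNormPow_of_zeroFree {α p ρ : ℝ} (hα : 0 < α) (hα1 : α ≤ 1) (hρ : ρ ≤ 1)
    {g : ℂ → ℂ} (hg : DifferentiableOn ℂ g (ball 0 ρ)) (h0 : ∀ z ∈ ball (0 : ℂ) ρ, g z ≠ 0)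
    {w : ℂ} (hw : ‖w‖ < ρ) :
    ENNReal.ofReal (‖g w‖ ^ p / truncKernel α ρ w) ≤ truncNormPow α p g ρ := by
  have hρ0 : 0 < ρ := (norm_nonneg w).trans_lt hw
  have hw' : w ∈ ball (0 : ℂ) ρ := by simpa using hw
  obtain ⟨h, hh, hgh⟩ := exists_sq_eq_rpow (p := p) hg h0
  rw [truncNormPow_eq_tsum hρ hρ0 hh hgh, hgh w hw']
  have h1 := ofReal_le_tsum_weighted (fun n => (coeffWeight_toReal_pos hα hα1 hρ0 hρ n).1)
    (hasSum_taylorCoeff hh hw') (hasSum_truncKernel hα hα1 hρ hw) (truncKernel_pos hα hα1 hρ hw)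
  refine h1.trans_eq (tsum_congr fun n => ?_)
  rw [ENNReal.ofReal_toReal (coeffWeight_ne_top hα hρ n)]

/-- For `α ≤ 1`, enlarging the modulus inside the disc but not on the circle decreases the
truncated norm. -/
theorem truncNormPow_le_of_majorant {α p ρ : ℝ} (hα1 : α ≤ 1) (hp : 0 < p) (hρ0 : 0 < ρ)
    (hρ : ρ < 1) {f g : ℂ → ℂ} (hf : AnalyticOnNhd ℂ f (closedBall 0 ρ))
    (hg : AnalyticOnNhd ℂ g (closedBall 0 ρ))
    (hfg : ∀ z ∈ closedBall (0 : ℂ) ρ, ‖f z‖ ≤ ‖g z‖)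
    (hfg' : ∀ z ∈ sphere (0 : ℂ) ρ, ‖f z‖ = ‖g z‖) :
    truncNormPow α p g ρ ≤ truncNormPow α p f ρ := by
  rw [truncNormPow_eq hp hρ0 hρ hf, truncNormPow_eq hp hρ0 hρ hg,
    integralMeanPow_congr_sphere hρ0.le hfg']
  refine ENNReal.ofReal_le_ofReal (add_le_add le_rfl ?_)
  have hVc : ContinuousOn (fun s : ℝ => 2 * (α - 1) * s * (1 - s ^ 2) ^ (α - 2)) (Icc 0 ρ) :=
    ContinuousOn.mul (by fun_prop) (ContinuousOn.rpow_const (by fun_prop)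
      fun s hs => Or.inl (by nlinarith [hs.1, hs.2]))
  refine intervalIntegral.integral_mono_on hρ0.le
    (ContinuousOn.intervalIntegrable ?_) (ContinuousOn.intervalIntegrable ?_) fun s hs => ?_
  · rw [uIcc_of_le hρ0.le]; exact (continuousOn_integralMeanPow hp hg).mul hVc
  · rw [uIcc_of_le hρ0.le]; exact (continuousOn_integralMeanPow hp hf).mul hVc
  · refine mul_le_mul_of_nonpos_right
      (integralMeanPow_mono_fun hp hf hg hfg hs.1 hs.2) ?_
    have h1 : 0 ≤ s * (1 - s ^ 2) ^ (α - 2) :=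
      mul_nonneg hs.1 (Real.rpow_nonneg (by nlinarith [hs.1, hs.2]) _)
    nlinarith

/-- A family of bounds on the truncated norms passes to the limit. -/
theorem ofReal_le_dirichletNormPow_of_trunc {α p : ℝ} (hα : 0 < α) (hα1 : α ≤ 1) {f : ℂ → ℂ}
    {w : ℂ} (hw : ‖w‖ < 1) {u : ℝ → ℝ} (hu : ContinuousAt u 1)
    (h : ∀ᶠ ρ in 𝓝 (1 : ℝ), ρ < 1 →
      ENNReal.ofReal (u ρ / truncKernel α ρ w) ≤ truncNormPow α p f ρ) :
    ENNReal.ofReal (u 1 * (1 - ‖w‖ ^ 2) ^ α) ≤ dirichletNormPow α p f := by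
  have hlt : 0 < 1 - ‖w‖ ^ 2 := by
    have := (sq_lt_one_iff₀ (norm_nonneg w)).2 hw
    linarith
  have h1 : Tendsto (fun k : ℕ => ENNReal.ofReal (u (1 - 1 / ((k : ℝ) + 2))
      / truncKernel α (1 - 1 / ((k : ℝ) + 2)) w)) atTop
      (𝓝 (ENNReal.ofReal (u 1 / (1 - ‖w‖ ^ 2) ^ (-α)))) :=
    ENNReal.tendsto_ofReal ((hu.tendsto.comp tendsto_one_sub_one_div).div
      (tendsto_truncKernel hα hα1 hw) (by positivity))
  rw [Real.rpow_neg hlt.le, div_inv_eq_mul] at h1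
  refine le_of_tendsto h1 ?_
  filter_upwards [tendsto_one_sub_one_div.eventually h] with k hk
  have h3 : 0 < 1 / ((k : ℝ) + 2) := by positivity
  exact (hk (by linarith)).trans (truncNormPow_mono (by linarith) f)

theorem pointwise_bound_of_le_one {α p : ℝ} (hα : 0 < α) (hα1 : α ≤ 1) (hp : 0 < p) {f : ℂ → ℂ}
    (hf : AnalyticOnNhd ℂ f (ball 0 1)) {w : ℂ} (hw : ‖w‖ < 1) :
    ENNReal.ofReal (‖f w‖ ^ p * (1 - ‖w‖ ^ 2) ^ α) ≤ dirichletNormPow α p f := by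
  by_cases hfw : f w = 0
  · simp [hfw, Real.zero_rpow hp.ne']
  refine ofReal_le_dirichletNormPow_of_trunc hα hα1 hw (u := fun _ => ‖f w‖ ^ p)
    continuousAt_const ?_
  filter_upwards [lt_mem_nhds hw] with ρ hwρ hρ
  have hρ0 : 0 < ρ := (norm_nonneg w).trans_lt hwρ
  have hfρ := hf.mono (closedBall_subset_ball hρ : closedBall (0 : ℂ) ρ ⊆ ball 0 1)
  have hwc : w ∈ closedBall (0 : ℂ) ρ := by simpa using hwρ.le
  obtain ⟨g, hg, hg0, hfg, hfg'⟩ := exists_zeroFree_majorant hfρ ⟨w, hwc, hfw⟩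
  calc ENNReal.ofReal (‖f w‖ ^ p / truncKernel α ρ w)
      ≤ ENNReal.ofReal (‖g w‖ ^ p / truncKernel α ρ w) := by
        have := truncKernel_pos hα hα1 hρ.le hwρ
        have := hfg w hwc
        gcongr
    _ ≤ truncNormPow α p g ρ := ofReal_le_truncNormPow_of_zeroFree hα hα1 hρ.le
        (hg.differentiableOn.mono ball_subset_closedBall) hg0 hwρ
    _ ≤ truncNormPow α p f ρ := truncNormPow_le_of_majorant hα1 hp hρ0 hρ hfρ hg hfg hfg'

/-- Since the canonical factor has modulus greater than `1` at `w`, this strict improvement excludes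
zeros of a function extremal at `w` with `f w ≠ 0`. -/
theorem pointwise_bound_of_le_one_of_zero {α p : ℝ} (hα : 0 < α) (hα1 : α ≤ 1) (hp : 0 < p)
    {f : ℂ → ℂ} (hf : AnalyticOnNhd ℂ f (ball 0 1)) {w : ℂ} (hw : ‖w‖ < 1) (hfw : f w ≠ 0)
    {a : ℂ} (ha : ‖a‖ < 1) (hfa : f a = 0) :
    ENNReal.ofReal ((‖f w‖ * ‖canonicalFactor 1 a w‖) ^ p * (1 - ‖w‖ ^ 2) ^ α)
      ≤ dirichletNormPow α p f := by
  have hwa : w - a ≠ 0 := by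
    rw [sub_ne_zero]; rintro rfl; exact hfw hfa
  -- The canonical factor belongs to the disc of radius `ρ`, so the bounded quantity now varies with
  -- `ρ`; only its continuity at `1` is needed.
  refine ofReal_le_dirichletNormPow_of_trunc hα hα1 hw
    (u := fun ρ => (‖f w‖ * ‖canonicalFactor ρ a w‖) ^ p) ?_ ?_
  · refine ContinuousAt.rpow_const (continuousAt_const.mul (ContinuousAt.norm ?_)) (Or.inr hp.le)
    simp only [canonicalFactor_apply]
    refine ContinuousAt.div (by fun_prop) (by fun_prop) ?_
    simpa using hwa
  filter_upwards [lt_mem_nhds hw, lt_mem_nhds ha] with ρ hwρ haρ hρ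
  have hρ0 : 0 < ρ := (norm_nonneg w).trans_lt hwρ
  have hfρ := hf.mono (closedBall_subset_ball hρ : closedBall (0 : ℂ) ρ ⊆ ball 0 1)
  have hwc : w ∈ closedBall (0 : ℂ) ρ := by simpa using hwρ.le
  obtain ⟨g, hg, hg0, hfg2, hfg, hfg'⟩ := exists_zeroFree_majorant_of_zero hfρ ⟨w, hwc, hfw⟩
    (by simpa using haρ) hfa
  calc ENNReal.ofReal ((‖f w‖ * ‖canonicalFactor ρ a w‖) ^ p / truncKernel α ρ w)
      ≤ ENNReal.ofReal (‖g w‖ ^ p / truncKernel α ρ w) := by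
        have := truncKernel_pos hα hα1 hρ.le hwρ
        have := hfg2 w hwc
        gcongr
    _ ≤ truncNormPow α p g ρ := ofReal_le_truncNormPow_of_zeroFree hα hα1 hρ.le
        (hg.differentiableOn.mono ball_subset_closedBall) hg0 hwρ
    _ ≤ truncNormPow α p f ρ := truncNormPow_le_of_majorant hα1 hp hρ0 hρ hfρ hg hfg hfg'

theorem one_sub_conj_mul_mem_slitPlane {w z : ℂ} (hw : ‖w‖ < 1) (hz : ‖z‖ < 1) :
    1 - conj w * z ∈ slitPlane := by
  have h : ‖-(conj w * z)‖ < 1 := by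
    rw [norm_neg, norm_mul, norm_conj]
    nlinarith [norm_nonneg w, norm_nonneg z]
  simpa [sub_eq_add_neg] using mem_slitPlane_of_norm_lt_one h

/-- Raising to the power `2/p` is ambiguous, so logarithms are compared instead: `(p/2) L + α log (1
- conj w * z)` has constant exponential, hence zero derivative, and is solved for `L`. -/
theorem exists_eq_cpow_of_exp_eq {α p : ℝ} (hp : 0 < p) {w lam : ℂ} (hw : ‖w‖ < 1) {L : ℂ → ℂ}
    (hL : DifferentiableOn ℂ L (ball 0 1))
    (h : ∀ z ∈ ball (0 : ℂ) 1, exp ((p / 2 : ℝ) * L z) = lam * (1 - conj w * z) ^ (-α : ℂ)) :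
    ∃ C : ℂ, ∀ z ∈ ball (0 : ℂ) 1,
      exp (L z) = C * (1 - conj w * z) ^ (((-2 * α / p : ℝ)) : ℂ) := by
  have hsl : ∀ z ∈ ball (0 : ℂ) 1, 1 - conj w * z ∈ slitPlane := fun z hz =>
    one_sub_conj_mul_mem_slitPlane hw (by simpa using hz)
  let G : ℂ → ℂ := fun z => (p / 2 : ℝ) * L z + α * log (1 - conj w * z)
  have hG : DifferentiableOn ℂ G (ball 0 1) :=
    (hL.const_mul _).add ((DifferentiableOn.clog (by fun_prop) hsl).const_mul _)
  have hexp : ∀ z ∈ ball (0 : ℂ) 1, exp (G z) = lam := by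
    intro z hz
    have h0 := slitPlane_ne_zero (hsl z hz)
    simp only [G]
    rw [exp_add, h z hz, cpow_def_of_ne_zero h0, mul_assoc, ← exp_add]
    simp [mul_comm]
  have hder : EqOn (deriv G) 0 (ball 0 1) := by
    intro z hz
    have h1 := (hG.differentiableAt (isOpen_ball.mem_nhds hz)).hasDerivAt.cexp
    have h2 : HasDerivAt (fun z => exp (G z)) 0 z := by
      refine (hasDerivAt_const z lam).congr_of_eventuallyEq ?_
      filter_upwards [isOpen_ball.mem_nhds hz] with y hy using hexp y hy
    have h3 := h1.unique h2
    exact (mul_eq_zero.1 h3).resolve_left (exp_ne_zero _)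
  refine ⟨exp (2 / p * G 0), fun z hz => ?_⟩
  have hconst : G z = G 0 := isOpen_ball.is_const_of_deriv_eq_zero
    (convex_ball (0 : ℂ) 1).isPreconnected hG hder hz (mem_ball_self one_pos)
  have h0 := slitPlane_ne_zero (hsl z hz)
  rw [← hconst, cpow_def_of_ne_zero h0, ← exp_add]
  congr 1
  have hp' : (p : ℂ) ≠ 0 := by exact_mod_cast hp.ne'
  simp only [G]
  push_cast
  field_simp
  ring

/-- No truncation is needed here: at `ρ = 1` the weights are the inverse binomial coefficients, and
equality in Cauchy–Schwarz gives `h` the coefficients of a multiple of `(1 - conj w * z)^(-α)`. -/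
theorem exists_eq_cpow_of_zeroFree {α p : ℝ} (hα : 0 < α) (hp : 0 < p) {f : ℂ → ℂ}
    (hf : AnalyticOnNhd ℂ f (ball 0 1)) {w : ℂ} (hw : ‖w‖ < 1)
    (h0 : ∀ z ∈ ball (0 : ℂ) 1, f z ≠ 0)
    (heq : ENNReal.ofReal (‖f w‖ ^ p * (1 - ‖w‖ ^ 2) ^ α) = dirichletNormPow α p f) :
    ∃ C : ℂ, ∀ z ∈ ball (0 : ℂ) 1,
      f z = C * (1 - conj w * z) ^ (((-2 * α / p : ℝ)) : ℂ) := by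
  have hw' : w ∈ ball (0 : ℂ) 1 := by simpa using hw
  have hlt : 0 < 1 - ‖w‖ ^ 2 := by
    have := (sq_lt_one_iff₀ (norm_nonneg w)).2 hw
    linarith
  obtain ⟨L, hL, hfL⟩ := exists_exp_eq_of_ne_zero hf.differentiableOn h0
  let h : ℂ → ℂ := fun z => exp ((p / 2 : ℝ) * L z)
  have hh : DifferentiableOn ℂ h (ball 0 1) := (hL.const_mul _).cexp
  have hfh : ∀ z ∈ ball (0 : ℂ) 1, ‖f z‖ ^ p = ‖h z‖ ^ 2 := fun z hz => by
    rw [hfL z hz, norm_exp_rpow]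
  rw [← truncNormPow_one, truncNormPow_eq_tsum le_rfl one_pos hh hfh, hfh w hw'] at heq
  simp only [coeffWeight_one hα] at heq
  set K := (1 - ‖w‖ ^ 2) ^ (-α) with hK
  have hK' : ‖h w‖ ^ 2 * (1 - ‖w‖ ^ 2) ^ α = ‖h w‖ ^ 2 / K := by
    rw [hK, Real.rpow_neg hlt.le, div_inv_eq_mul]
  rw [hK'] at heq
  have hcoef := eq_of_ofReal_eq_tsum_weighted (fun n => inv_pos.2 (binomCoeff_pos hα n))
    (hasSum_taylorCoeff hh hw') (hasSum_kernel_diag α hw) (by positivity) heq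
  obtain ⟨C, hC⟩ := exists_eq_cpow_of_exp_eq (α := α) (lam := h w / K) hp hw hL (by
    intro z hz
    have h1 := hasSum_taylorCoeff hh hz
    have hz' : ‖z‖ < 1 := by simpa using hz
    have h2 := (hasSum_binomCoeff α (x := conj w * z) (by
      rw [norm_mul, norm_conj]
      nlinarith [norm_nonneg w, norm_nonneg z])).mul_left (h w / K)
    refine h1.unique (h2.congr_fun fun n => ?_)
    rw [hcoef n, mul_pow]
    push_cast
    rw [div_inv_eq_mul]
    ring)
  exact ⟨C, fun z hz => (hfL z hz).trans (hC z hz)⟩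

theorem exists_eq_cpow_of_le_one {α p : ℝ} (hα : 0 < α) (hα1 : α ≤ 1) (hp : 0 < p) {f : ℂ → ℂ}
    (hf : AnalyticOnNhd ℂ f (ball 0 1)) {w : ℂ} (hw : ‖w‖ < 1)
    (heq : ENNReal.ofReal (‖f w‖ ^ p * (1 - ‖w‖ ^ 2) ^ α) = dirichletNormPow α p f) :
    ∃ C : ℂ, ∀ z ∈ ball (0 : ℂ) 1,
      f z = C * (1 - conj w * z) ^ (((-2 * α / p : ℝ)) : ℂ) := by
  have hpos : ∀ z : ℂ, ‖z‖ < 1 → 0 < 1 - ‖z‖ ^ 2 := fun z hz => by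
    have := (sq_lt_one_iff₀ (norm_nonneg z)).2 hz
    linarith
  have hlt := hpos w hw
  -- If `f w = 0`, equality makes the norm zero, and the bound at every other point then gives `f =
  -- 0`, that is `C = 0`.
  by_cases hfw : f w = 0
  · refine ⟨0, fun z hz => ?_⟩
    have hz' : ‖z‖ < 1 := by simpa using hz
    have h1 := pointwise_bound_of_le_one hα hα1 hp hf hz'
    rw [← heq, hfw, norm_zero, Real.zero_rpow hp.ne', zero_mul, ENNReal.ofReal_zero,
      nonpos_iff_eq_zero, ENNReal.ofReal_eq_zero] at h1
    have h2 : ‖f z‖ ^ p ≤ 0 := by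
      by_contra h
      push Not at h
      have := mul_pos h (Real.rpow_pos_of_pos (hpos z hz') α)
      linarith
    have h3 : ‖f z‖ ^ p = 0 := le_antisymm h2 (by positivity)
    rw [Real.rpow_eq_zero (norm_nonneg _) hp.ne', norm_eq_zero] at h3
    rw [h3, zero_mul]
  refine exists_eq_cpow_of_zeroFree hα hp hf hw (fun a ha hfa => ?_) heq
  have ha' : ‖a‖ < 1 := by simpa using ha
  have h1 := pointwise_bound_of_le_one_of_zero hα hα1 hp hf hw hfw ha' hfa
  rw [← heq, ENNReal.ofReal_le_ofReal_iff (by positivity)] at h1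
  have h2 : 1 < ‖canonicalFactor 1 a w‖ := one_lt_norm_canonicalFactor ha (by simpa using hw)
    (by rintro rfl; exact hfw hfa)
  have h3 : ‖f w‖ ^ p < (‖f w‖ * ‖canonicalFactor 1 a w‖) ^ p :=
    Real.rpow_lt_rpow (norm_nonneg _)
      (lt_mul_of_one_lt_right (norm_pos_iff.2 hfw) h2) hp
  have h4 := mul_lt_mul_of_pos_right h3 (Real.rpow_pos_of_pos hlt α)
  linarith

/-! ### The case `α > 1`: radial and area forms of the Bergman norm -/

/-- A function with constant integral means up to the radius `ρ` is constant. -/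
theorem eq_of_integralMeanPow_eq {p ρ : ℝ} (hp : 0 < p) (hρ0 : 0 < ρ) {F : ℂ → ℂ}
    (hF : AnalyticOnNhd ℂ F (closedBall 0 ρ)) (hM : integralMeanPow p F ρ = ‖F 0‖ ^ p)
    {z : ℂ} (hz : z ∈ ball (0 : ℂ) ρ) : F z = F 0 := by
  have h0c : (0 : ℂ) ∈ closedBall (0 : ℂ) ρ := mem_closedBall_self hρ0.le
  have h0b : (0 : ℂ) ∈ ball (0 : ℂ) ρ := mem_ball_self hρ0
  by_cases hne : ∃ z ∈ closedBall (0 : ℂ) ρ, F z ≠ 0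
  swap
  · push Not at hne
    rw [hne z (ball_subset_closedBall hz), hne 0 h0c]
  -- No analytic function with the same modulus on the circle can exceed `‖F 0‖` at the origin. A
  -- zero of `F` would produce a majorant that does.
  have hbound : ∀ g : ℂ → ℂ, AnalyticOnNhd ℂ g (closedBall 0 ρ) →
      (∀ z ∈ sphere (0 : ℂ) ρ, ‖F z‖ = ‖g z‖) → ‖g 0‖ ^ p ≤ ‖F 0‖ ^ p := by
    intro g hg hFg
    rw [← hM, integralMeanPow_congr_sphere hρ0.le hFg, ← integralMeanPow_zero]
    exact integralMeanPow_le hp hg le_rfl hρ0.le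
  have hF0 : F 0 ≠ 0 := by
    intro h
    obtain ⟨g, hg, hg0, -, hFg⟩ := exists_zeroFree_majorant hF hne
    have h1 := hbound g hg hFg
    rw [h, norm_zero, Real.zero_rpow hp.ne'] at h1
    have := Real.rpow_pos_of_pos (norm_pos_iff.2 (hg0 0 h0b)) p
    linarith
  have hzf : ∀ a ∈ ball (0 : ℂ) ρ, F a ≠ 0 := by
    intro a ha hFa
    obtain ⟨g, hg, -, hFg2, -, hFg⟩ := exists_zeroFree_majorant_of_zero hF hne ha hFa
    have h1 := hbound g hg hFg
    have h2 : ‖F 0‖ < ‖g 0‖ := (lt_mul_of_one_lt_right (norm_pos_iff.2 hF0)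
      (one_lt_norm_canonicalFactor ha h0b (by rintro rfl; exact hF0 hFa))).trans_le (hFg2 0 h0c)
    have h3 := Real.rpow_lt_rpow (norm_nonneg _) h2 hp
    linarith
  have hFd := hF.differentiableOn.mono ball_subset_closedBall
  obtain ⟨h, hh, hFh⟩ := exists_sq_eq_rpow (p := p) hFd hzf
  -- The constant term of the Parseval sum already exhausts the mean at radius `s`, so all other
  -- coefficients vanish.
  have hcoef : ∀ n, n ≠ 0 → taylorCoeff h n = 0 := by
    intro n hn
    obtain ⟨s, hs0, hs⟩ := exists_between hρ0
    have hle : integralMeanPow p F s ≤ ‖F 0‖ ^ p := hM ▸ integralMeanPow_le hp hF hs0.le hs.le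
    rw [integralMeanPow_eq_tsum hh hFh hs0.le hs, hFh 0 h0b] at hle
    have hsum := summable_norm_sq_taylorCoeff hh hs0.le hs
    have h1 := hsum.sum_le_tsum {0, n} fun i _ => by positivity
    rw [Finset.sum_pair hn.symm] at h1
    have h2 : taylorCoeff h 0 = h 0 := by simp [taylorCoeff]
    rw [h2] at h1
    simp only [mul_zero, pow_zero, mul_one] at h1
    have h3 : ‖taylorCoeff h n‖ ^ 2 * s ^ (2 * n) ≤ 0 := by linarith
    by_contra hc
    have : 0 < ‖taylorCoeff h n‖ ^ 2 * s ^ (2 * n) := by positivity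
    linarith
  have hconst : ∀ z ∈ ball (0 : ℂ) ρ, ‖F z‖ = ‖F 0‖ := by
    have hz0 : ∀ z ∈ ball (0 : ℂ) ρ, h z = taylorCoeff h 0 := by
      intro z hz
      refine (hasSum_taylorCoeff hh hz).unique ?_
      have := hasSum_single (f := fun n => taylorCoeff h n * z ^ n) 0
        fun n hn => by simp [hcoef n hn]
      simpa using this
    intro z hz
    have h1 : ‖F z‖ ^ p = ‖F 0‖ ^ p := by rw [hFh z hz, hFh 0 h0b, hz0 z hz, hz0 0 h0b]
    exact (Real.rpow_left_inj (norm_nonneg _) (norm_nonneg _) hp.ne').1 h1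
  exact eqOn_of_isPreconnected_of_isMaxOn_norm (convex_ball (0 : ℂ) ρ).isPreconnected
    isOpen_ball hFd h0b (fun z hz => (hconst z hz).le) hz

/-- The radial density of the Bergman norm. -/
noncomputable def radialDensity (α s : ℝ) : ℝ := 2 * (α - 1) * s * (1 - s ^ 2) ^ (α - 2)

theorem radialDensity_pos {α s : ℝ} (hα : 1 < α) (hs : s ∈ Ioo (0 : ℝ) 1) :
    0 < radialDensity α s := by
  have h1 : 0 < 1 - s ^ 2 := by nlinarith [hs.1, hs.2]
  have := hs.1
  have : 0 < α - 1 := by linarith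
  unfold radialDensity
  positivity

/-- The case `n = 0` of `integral_pow_weight` with `α - 1` in place of `α`. -/
theorem lintegral_radialDensity {α : ℝ} (hα : 1 < α) :
    ∫⁻ s in Ioo (0 : ℝ) 1, ENNReal.ofReal (radialDensity α s) = 1 := by
  have hα' : 0 < α - 1 := by linarith
  have h1 := integral_pow_weight hα' 0
  have hb := binomCoeff_succ (α - 1) 0
  simp only [binomCoeff_zero, Nat.cast_zero, zero_add, one_mul, add_zero, mul_one, mul_zero] at h1 hb
  rw [hb] at h1
  have h2 : ∀ s : ℝ, radialDensity α s = (α - 1) * (2 * s ^ 1 * (1 - s ^ 2) ^ (α - 1 - 1)) := by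
    intro s
    rw [radialDensity, show α - 1 - 1 = α - 2 by ring]
    ring
  rw [← ofReal_integral_eq_lintegral_ofReal, ← integral_Ioc_eq_integral_Ioo]
  · simp only [h2]
    rw [integral_const_mul, h1, mul_inv_cancel₀ hα'.ne', ENNReal.ofReal_one]
  · rw [show radialDensity α = _ from funext h2]
    exact ((integrableOn_pow_weight hα' 0).mono_set Ioo_subset_Ioc_self).const_mul _
  · exact (ae_restrict_iff' measurableSet_Ioo).2
      (Eventually.of_forall fun s hs => (radialDensity_pos hα hs).le)

/-- The radial form of the Bergman norm, for `α > 1`. -/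
noncomputable def radialNormPow (α p : ℝ) (f : ℂ → ℂ) : ENNReal :=
  ∫⁻ s in Ioo (0 : ℝ) 1, ENNReal.ofReal (integralMeanPow p f s * radialDensity α s)

/-- After integration by parts on `[0, ρ]` the two sides differ by the boundary term, which is
nonnegative; `ρ → 1` follows by exhaustion. -/
theorem radialNormPow_le_dirichletNormPow {α p : ℝ} (hα : 1 < α) (hp : 0 < p) {f : ℂ → ℂ}
    (hf : AnalyticOnNhd ℂ f (ball 0 1)) : radialNormPow α p f ≤ dirichletNormPow α p f := by
  refine le_of_tendsto (tendsto_lintegral_Ioo _) ?_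
  filter_upwards with k
  set ρ : ℝ := 1 - 1 / ((k : ℝ) + 2) with hρdef
  -- The shift by `2` makes every radius positive, starting from `1/2`.
  have hk : 1 / ((k : ℝ) + 2) < 1 := by
    rw [div_lt_one (by positivity)]
    have : (0 : ℝ) ≤ k := by positivity
    linarith
  have hk0 : 0 < 1 / ((k : ℝ) + 2) := by positivity
  have hρ0 : 0 < ρ := by linarith
  have hρ : ρ < 1 := by linarith
  have hfρ := hf.mono (closedBall_subset_ball hρ : closedBall (0 : ℂ) ρ ⊆ ball 0 1)
  refine le_trans ?_ (truncNormPow_mono hρ.le f)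
  rw [truncNormPow_eq hp hρ0 hρ hfρ, intervalIntegral.integral_of_le hρ0.le,
    integral_Ioc_eq_integral_Ioo]
  have hVc : ContinuousOn (fun s : ℝ => 2 * (α - 1) * s * (1 - s ^ 2) ^ (α - 2)) (Icc 0 ρ) :=
    ContinuousOn.mul (by fun_prop) (ContinuousOn.rpow_const (by fun_prop)
      fun s hs => Or.inl (by nlinarith [hs.1, hs.2]))
  rw [← ofReal_integral_eq_lintegral_ofReal]
  · refine ENNReal.ofReal_le_ofReal (le_add_of_nonneg_left ?_)
    exact mul_nonneg (integralMeanPow_nonneg _ _ _) (Real.rpow_nonneg (by nlinarith) _)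
  · exact (((continuousOn_integralMeanPow hp hfρ).mul hVc).integrableOn_Icc).mono_set
      Ioo_subset_Icc_self
  · exact (ae_restrict_iff' measurableSet_Ioo).2 (Eventually.of_forall fun s hs =>
      mul_nonneg (integralMeanPow_nonneg _ _ _)
        (radialDensity_pos hα ⟨hs.1, hs.2.trans hρ⟩).le)

theorem norm_rpow_le_integralMeanPow {p : ℝ} (hp : 0 < p) {F : ℂ → ℂ}
    (hF : AnalyticOnNhd ℂ F (ball 0 1)) {s : ℝ} (hs : s ∈ Ioo (0 : ℝ) 1) :
    ‖F 0‖ ^ p ≤ integralMeanPow p F s := by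
  rw [← integralMeanPow_zero]
  exact integralMeanPow_le hp (hF.mono (closedBall_subset_ball hs.2)) le_rfl hs.1.le

theorem lintegral_const_mul_radialDensity {α p : ℝ} (hα : 1 < α) (F : ℂ → ℂ) :
    ∫⁻ s in Ioo (0 : ℝ) 1, ENNReal.ofReal (‖F 0‖ ^ p * radialDensity α s)
      = ENNReal.ofReal (‖F 0‖ ^ p) := by
  have h : ∀ s, ENNReal.ofReal (‖F 0‖ ^ p * radialDensity α s)
      = ENNReal.ofReal (‖F 0‖ ^ p) * ENNReal.ofReal (radialDensity α s) := fun s =>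
    ENNReal.ofReal_mul (by positivity)
  simp only [h]
  rw [lintegral_const_mul _ (by unfold radialDensity; fun_prop), lintegral_radialDensity hα,
    mul_one]

theorem ofReal_le_radialNormPow {α p : ℝ} (hα : 1 < α) (hp : 0 < p) {F : ℂ → ℂ}
    (hF : AnalyticOnNhd ℂ F (ball 0 1)) : ENNReal.ofReal (‖F 0‖ ^ p) ≤ radialNormPow α p F := by
  rw [← lintegral_const_mul_radialDensity hα]
  refine setLIntegral_mono' measurableSet_Ioo fun s hs => ENNReal.ofReal_le_ofReal ?_
  exact mul_le_mul_of_nonneg_right (norm_rpow_le_integralMeanPow hp hF hs)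
    (radialDensity_pos hα hs).le

/-- The mean dominates `‖F 0‖ ^ p` at every radius, so equal integrals force equality at almost
every radius, in particular at some radius beyond `‖z‖`. -/
theorem eq_of_radialNormPow_le {α p : ℝ} (hα : 1 < α) (hp : 0 < p) {F : ℂ → ℂ}
    (hF : AnalyticOnNhd ℂ F (ball 0 1))
    (h : radialNormPow α p F ≤ ENNReal.ofReal (‖F 0‖ ^ p)) {z : ℂ} (hz : z ∈ ball (0 : ℂ) 1) :
    F z = F 0 := by
  rw [← lintegral_const_mul_radialDensity hα] at h
  have hMc : ContinuousOn (integralMeanPow p F) (Ioo 0 1) := by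
    intro s hs
    obtain ⟨t, hst, ht⟩ := exists_between hs.2
    exact ((continuousOn_integralMeanPow hp (hF.mono (closedBall_subset_ball ht))).continuousAt
      (Icc_mem_nhds hs.1 hst)).continuousWithinAt
  have hae := ae_eq_of_ae_le_of_lintegral_le
    (f := fun s => ENNReal.ofReal (‖F 0‖ ^ p * radialDensity α s))
    (g := fun s => ENNReal.ofReal (integralMeanPow p F s * radialDensity α s))
    ((ae_restrict_iff' measurableSet_Ioo).2 (Eventually.of_forall fun s hs =>
      ENNReal.ofReal_le_ofReal (mul_le_mul_of_nonneg_right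
        (norm_rpow_le_integralMeanPow hp hF hs) (radialDensity_pos hα hs).le)))
    (by rw [lintegral_const_mul_radialDensity hα]; exact ENNReal.ofReal_ne_top)
    ((hMc.aemeasurable measurableSet_Ioo).mul
      (by unfold radialDensity; fun_prop)).ennreal_ofReal h
  have hz' : ‖z‖ < 1 := by simpa using hz
  have hae2 : ∀ᵐ s, s ∈ Ioo (0 : ℝ) 1 → integralMeanPow p F s = ‖F 0‖ ^ p := by
    filter_upwards [(ae_restrict_iff' measurableSet_Ioo).1 hae] with s hs hs1
    have hd := radialDensity_pos hα hs1
    have h1 := (ENNReal.ofReal_eq_ofReal_iff (by positivity)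
      (mul_nonneg (integralMeanPow_nonneg _ _ _) hd.le)).1 (hs hs1)
    exact (mul_right_cancel₀ hd.ne' h1).symm
  obtain ⟨s, hs, hMs⟩ : ∃ s ∈ Ioo ‖z‖ 1, integralMeanPow p F s = ‖F 0‖ ^ p := by
    by_contra hcon
    push Not at hcon
    have hnull : volume (Ioo ‖z‖ 1) = 0 := by
      refine measure_mono_null (fun s hs => ?_) hae2
      simp only [mem_compl_iff, mem_ofPred_eq]
      intro h
      exact hcon s hs (h ⟨(norm_nonneg z).trans_lt hs.1, hs.2⟩)
    rw [Real.volume_Ioo, ENNReal.ofReal_eq_zero] at hnull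
    linarith
  exact eq_of_integralMeanPow_eq hp ((norm_nonneg z).trans_lt hs.1)
    (hF.mono (closedBall_subset_ball hs.2)) hMs (by simpa using hs.1)

/-- The density of the Bergman norm with respect to area. -/
noncomputable def areaDensity (α p : ℝ) (f : ℂ → ℂ) (z : ℂ) : ℝ :=
  ‖f z‖ ^ p * ((α - 1) / Real.pi) * (1 - ‖z‖ ^ 2) ^ (α - 2)

theorem continuousOn_areaDensity {α p : ℝ} (hp : 0 < p) {f : ℂ → ℂ}
    (hf : AnalyticOnNhd ℂ f (ball 0 1)) : ContinuousOn (areaDensity α p f) (ball 0 1) := by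
  refine ContinuousOn.mul (ContinuousOn.mul
    (hf.continuousOn.norm.rpow_const fun _ _ => Or.inr hp.le) continuousOn_const)
    (ContinuousOn.rpow_const (by fun_prop) fun z hz => Or.inl ?_)
  have hz' : ‖z‖ < 1 := by simpa using hz
  nlinarith [norm_nonneg z]

theorem areaDensity_nonneg {α p : ℝ} (hα : 1 < α) (f : ℂ → ℂ) {z : ℂ}
    (hz : z ∈ ball (0 : ℂ) 1) : 0 ≤ areaDensity α p f z := by
  have hz' : ‖z‖ < 1 := by simpa using hz
  have h1 : 0 < 1 - ‖z‖ ^ 2 := by nlinarith [norm_nonneg z]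
  have : 0 < α - 1 := by linarith
  have := Real.pi_pos
  unfold areaDensity
  positivity

theorem polarCoord_symm_eq_circleMap (q : ℝ × ℝ) :
    Complex.polarCoord.symm q = circleMap 0 q.1 q.2 := by
  rw [Complex.polarCoord_symm_apply, circleMap_zero, exp_mul_I, ofReal_cos, ofReal_sin]

theorem radialNormPow_eq_lintegral {α p : ℝ} (hα : 1 < α) (hp : 0 < p) {f : ℂ → ℂ}
    (hf : AnalyticOnNhd ℂ f (ball 0 1)) :
    radialNormPow α p f = ∫⁻ z in ball (0 : ℂ) 1, ENNReal.ofReal (areaDensity α p f z) := by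
  rw [← lintegral_indicator measurableSet_ball, ← Complex.lintegral_comp_polarCoord_symm]
  have hcm : ∀ q ∈ Ioo (0 : ℝ) 1 ×ˢ Ioo (-Real.pi) Real.pi,
      circleMap 0 q.1 q.2 ∈ ball (0 : ℂ) 1 := by
    rintro ⟨r, θ⟩ ⟨hr, -⟩
    simpa [abs_of_pos hr.1] using hr.2
  have hset : ∫⁻ q in polarCoord.target, ENNReal.ofReal q.1 •
        (ball (0 : ℂ) 1).indicator (fun z => ENNReal.ofReal (areaDensity α p f z))
          (Complex.polarCoord.symm q)
      = ∫⁻ q in Ioo (0 : ℝ) 1 ×ˢ Ioo (-Real.pi) Real.pi,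
          ENNReal.ofReal (q.1 * areaDensity α p f (circleMap 0 q.1 q.2)) := by
    rw [← lintegral_indicator polarCoord.open_target.measurableSet,
      ← lintegral_indicator (measurableSet_Ioo.prod measurableSet_Ioo)]
    refine lintegral_congr fun q => ?_
    by_cases hq : q ∈ Ioo (0 : ℝ) 1 ×ˢ Ioo (-Real.pi) Real.pi
    · have hq' : q ∈ polarCoord.target := ⟨hq.1.1, hq.2⟩
      rw [indicator_of_mem hq, indicator_of_mem hq', polarCoord_symm_eq_circleMap,
        indicator_of_mem (hcm q hq), smul_eq_mul, ENNReal.ofReal_mul hq.1.1.le]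
    · rw [indicator_of_notMem hq]
      by_cases hq' : q ∈ polarCoord.target
      · rw [indicator_of_mem hq', polarCoord_symm_eq_circleMap, indicator_of_notMem, smul_zero]
        intro hb
        refine hq ⟨⟨hq'.1, ?_⟩, hq'.2⟩
        have : 0 < q.1 := hq'.1
        simpa [abs_of_pos this] using hb
      · rw [indicator_of_notMem hq']
  have hcontM : Continuous fun q : ℝ × ℝ => circleMap 0 q.1 q.2 := by
    unfold circleMap; fun_prop
  rw [hset, Measure.volume_eq_prod, ← Measure.prod_restrict, lintegral_prod]
  swap
  · rw [Measure.prod_restrict, ← Measure.volume_eq_prod]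
    refine (ContinuousOn.aemeasurable ?_ (measurableSet_Ioo.prod measurableSet_Ioo)).ennreal_ofReal
    exact continuousOn_fst.mul ((continuousOn_areaDensity hp hf).comp hcontM.continuousOn hcm)
  refine setLIntegral_congr_fun measurableSet_Ioo fun r hr => ?_
  have hr1 : 0 < 1 - r ^ 2 := by nlinarith [hr.1, hr.2]
  have hball : ∀ θ, circleMap 0 r θ ∈ ball (0 : ℂ) 1 := fun θ => by
    simpa [abs_of_pos hr.1] using hr.2
  have hcont : Continuous fun θ => r * areaDensity α p f (circleMap 0 r θ) :=
    continuous_const.mul ((continuousOn_areaDensity hp hf).comp_continuous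
      (continuous_circleMap 0 r) hball)
  have hpi : -Real.pi ≤ Real.pi := by linarith [Real.pi_pos]
  simp only
  rw [← ofReal_integral_eq_lintegral_ofReal
    (hcont.integrableOn_Icc.mono_set Ioo_subset_Icc_self)
    (Eventually.of_forall fun θ => mul_nonneg hr.1.le (areaDensity_nonneg hα f (hball θ)))]
  congr 1
  rw [← integral_Ioc_eq_integral_Ioo, ← intervalIntegral.integral_of_le hpi]
  -- Polar coordinates use angles in `(-π, π)` and the circle average uses `(0, 2π)`; periodicity
  -- reconciles them.
  have hper : Function.Periodic (fun θ => r * areaDensity α p f (circleMap 0 r θ))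
      (2 * Real.pi) := fun θ => by simp only [periodic_circleMap 0 r θ]
  have hshift := hper.intervalIntegral_add_eq (-Real.pi) 0
  rw [show -Real.pi + 2 * Real.pi = Real.pi by ring, zero_add] at hshift
  rw [hshift]
  have hval : ∀ θ, r * areaDensity α p f (circleMap 0 r θ)
      = (r * ((α - 1) / Real.pi) * (1 - r ^ 2) ^ (α - 2)) * ‖f (circleMap 0 r θ)‖ ^ p := by
    intro θ
    simp only [areaDensity, norm_circleMap_zero, sq_abs]
    ring
  simp only [hval]
  rw [intervalIntegral.integral_const_mul, integralMeanPow, Real.circleAverage_def, radialDensity,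
    smul_eq_mul]
  have := Real.pi_ne_zero
  field_simp

/-! ### The disc involution and conformal invariance -/

/-- The involutive disc automorphism exchanging `0` and `w`. -/
noncomputable def discInvolution (w z : ℂ) : ℂ := (w - z) / (1 - conj w * z)

theorem one_sub_conj_mul_ne_zero {w z : ℂ} (hw : ‖w‖ < 1) (hz : ‖z‖ < 1) :
    1 - conj w * z ≠ 0 := slitPlane_ne_zero (one_sub_conj_mul_mem_slitPlane hw hz)

theorem one_sub_norm_sq_discInvolution {w z : ℂ} (hw : ‖w‖ < 1) (hz : ‖z‖ < 1) :
    1 - ‖discInvolution w z‖ ^ 2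
      = (1 - ‖w‖ ^ 2) * (1 - ‖z‖ ^ 2) / ‖1 - conj w * z‖ ^ 2 := by
  have h0 : ‖1 - conj w * z‖ ≠ 0 := norm_ne_zero_iff.2 (one_sub_conj_mul_ne_zero hw hz)
  have h := norm_sq_sub_conj_mul 1 w z
  simp only [ofReal_one, one_pow, one_mul] at h
  rw [discInvolution, norm_div, div_pow, norm_sub_rev w z, eq_div_iff (pow_ne_zero 2 h0),
    sub_mul, div_mul_cancel₀ _ (pow_ne_zero 2 h0)]
  linarith

theorem norm_discInvolution_lt_one {w z : ℂ} (hw : ‖w‖ < 1) (hz : ‖z‖ < 1) :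
    ‖discInvolution w z‖ < 1 := by
  have h := one_sub_norm_sq_discInvolution hw hz
  have h0 : 0 < ‖1 - conj w * z‖ := norm_pos_iff.2 (one_sub_conj_mul_ne_zero hw hz)
  have h1 : 0 < 1 - ‖w‖ ^ 2 := by nlinarith [norm_nonneg w]
  have h2 : 0 < 1 - ‖z‖ ^ 2 := by nlinarith [norm_nonneg z]
  have h3 : 0 < 1 - ‖discInvolution w z‖ ^ 2 := by rw [h]; positivity
  exact (sq_lt_one_iff₀ (norm_nonneg _)).1 (by linarith)

theorem one_sub_conj_mul_discInvolution {w z : ℂ} (hw : ‖w‖ < 1) (hz : ‖z‖ < 1) :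
    1 - conj w * discInvolution w z = ((1 - ‖w‖ ^ 2 : ℝ) : ℂ) * (1 - conj w * z)⁻¹ := by
  have h0 := one_sub_conj_mul_ne_zero hw hz
  have h1 : ((‖w‖ : ℂ)) ^ 2 = conj w * w := (conj_mul' w).symm
  rw [discInvolution]
  push_cast
  rw [h1]
  field_simp
  ring

theorem discInvolution_discInvolution {w z : ℂ} (hw : ‖w‖ < 1) (hz : ‖z‖ < 1) :
    discInvolution w (discInvolution w z) = z := by
  have h0 := one_sub_conj_mul_ne_zero hw hz
  have h1 := one_sub_conj_mul_discInvolution hw hz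
  have h2 : ((1 - ‖w‖ ^ 2 : ℝ) : ℂ) ≠ 0 := by
    exact_mod_cast (by nlinarith [norm_nonneg w] : 1 - ‖w‖ ^ 2 ≠ 0)
  have h3 : ((1 - ‖w‖ ^ 2 : ℝ) : ℂ) = 1 - conj w * w := by
    push_cast; rw [conj_mul']
  rw [discInvolution, h1, div_eq_iff (mul_ne_zero h2 (inv_ne_zero h0)), h3, discInvolution]
  linear_combination (-w) * mul_inv_cancel₀ h0

theorem hasDerivAt_discInvolution {w z : ℂ} (hw : ‖w‖ < 1) (hz : ‖z‖ < 1) :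
    HasDerivAt (discInvolution w) (-((1 - ‖w‖ ^ 2 : ℝ) : ℂ) / (1 - conj w * z) ^ 2) z := by
  have h0 := one_sub_conj_mul_ne_zero hw hz
  have h1 : HasDerivAt (fun z => w - z) (-1) z := (hasDerivAt_id z).const_sub w
  have h2 : HasDerivAt (fun z => 1 - conj w * z) (-(conj w)) z := by
    simpa using ((hasDerivAt_id z).const_mul (conj w)).const_sub 1
  refine (h1.div h2 h0).congr_deriv ?_
  push_cast
  rw [← conj_mul']
  ring

theorem det_restrictScalars_toSpanSingleton (c : ℂ) :
    ((ContinuousLinearMap.toSpanSingleton ℂ c).restrictScalars ℝ).det = ‖c‖ ^ 2 := by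
  rw [← normSq_eq_norm_sq, ← Algebra.norm_complex_apply, Algebra.norm_apply]
  unfold ContinuousLinearMap.det
  congr 1
  ext
  simp [mul_comm]

theorem image_discInvolution_ball {w : ℂ} (hw : ‖w‖ < 1) :
    discInvolution w '' ball 0 1 = ball 0 1 := by
  ext z
  constructor
  · rintro ⟨y, hy, rfl⟩
    simpa using norm_discInvolution_lt_one hw (by simpa using hy)
  · intro hz
    have hz' : ‖z‖ < 1 := by simpa using hz
    exact ⟨discInvolution w z, by simpa using norm_discInvolution_lt_one hw hz',
      discInvolution_discInvolution hw hz'⟩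

/-- The weighted composition of `f` with the disc involution. -/
noncomputable def weightedComp (α p : ℝ) (w : ℂ) (f : ℂ → ℂ) (z : ℂ) : ℂ :=
  f (discInvolution w z) * (1 - conj w * z) ^ (((-2 * α / p : ℝ)) : ℂ)

theorem analyticOnNhd_weightedComp {α p : ℝ} {w : ℂ} (hw : ‖w‖ < 1) {f : ℂ → ℂ}
    (hf : AnalyticOnNhd ℂ f (ball 0 1)) : AnalyticOnNhd ℂ (weightedComp α p w f) (ball 0 1) := by
  refine DifferentiableOn.analyticOnNhd (DifferentiableOn.mul ?_ ?_) isOpen_ball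
  · refine hf.differentiableOn.comp (t := ball 0 1) (fun z hz => ?_) fun z hz => ?_
    · exact (hasDerivAt_discInvolution hw
        (by simpa using hz)).differentiableAt.differentiableWithinAt
    · simpa using norm_discInvolution_lt_one hw (by simpa using hz)
  · exact DifferentiableOn.cpow_const (by fun_prop) fun z hz =>
      one_sub_conj_mul_mem_slitPlane hw (by simpa using hz)

/-- In the change of variables the Jacobian is `(1-|w|²)²/|1 - conj w * z|⁴`. Together with the
transformed `(1-|z|²)^(α-2)` it leaves `(1-|w|²)^α |1 - conj w * z|^(-2α)`, and the last power is
the `p`-th power of the modulus of the factor in `weightedComp`. -/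
theorem radialNormPow_weightedComp {α p : ℝ} (hα : 1 < α) (hp : 0 < p) {w : ℂ} (hw : ‖w‖ < 1)
    {f : ℂ → ℂ} (hf : AnalyticOnNhd ℂ f (ball 0 1)) :
    radialNormPow α p f
      = ENNReal.ofReal ((1 - ‖w‖ ^ 2) ^ α) * radialNormPow α p (weightedComp α p w f) := by
  rw [radialNormPow_eq_lintegral hα hp hf,
    radialNormPow_eq_lintegral hα hp (analyticOnNhd_weightedComp hw hf)]
  conv_lhs => rw [← image_discInvolution_ball hw]
  rw [lintegral_image_eq_lintegral_abs_det_fderiv_mul volume measurableSet_ball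
    (f' := fun z => (ContinuousLinearMap.toSpanSingleton ℂ
      (-((1 - ‖w‖ ^ 2 : ℝ) : ℂ) / (1 - conj w * z) ^ 2)).restrictScalars ℝ)
    (fun z hz => ((hasDerivAt_discInvolution hw
      (by simpa using hz)).hasFDerivAt.restrictScalars ℝ).hasFDerivWithinAt)
    (fun x hx y hy hxy => by
      rw [← discInvolution_discInvolution hw (by simpa using hx : ‖x‖ < 1), hxy,
        discInvolution_discInvolution hw (by simpa using hy)])]
  have hwt : 0 < 1 - ‖w‖ ^ 2 := by nlinarith [norm_nonneg w]
  rw [← lintegral_const_mul' _ _ ENNReal.ofReal_ne_top]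
  refine setLIntegral_congr_fun measurableSet_ball fun z hz => ?_
  have hz' : ‖z‖ < 1 := by simpa using hz
  have hzt : 0 < 1 - ‖z‖ ^ 2 := by nlinarith [norm_nonneg z]
  have hu : 0 < ‖1 - conj w * z‖ := norm_pos_iff.2 (one_sub_conj_mul_ne_zero hw hz')
  rw [det_restrictScalars_toSpanSingleton, abs_of_nonneg (by positivity),
    ← ENNReal.ofReal_mul (by positivity), ← ENNReal.ofReal_mul (by positivity)]
  congr 1
  simp only [areaDensity, weightedComp]
  rw [one_sub_norm_sq_discInvolution hw hz', norm_mul, norm_cpow_real, norm_div, norm_neg,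
    norm_real, Real.norm_of_nonneg hwt.le, norm_pow, Real.mul_rpow (by positivity) (by positivity),
    ← Real.rpow_mul hu.le, Real.div_rpow (by positivity) (by positivity),
    Real.mul_rpow hwt.le hzt.le]
  have e1 : -2 * α / p * p = -(2 * α) := by field_simp
  have e2 : (1 - ‖w‖ ^ 2) ^ α = (1 - ‖w‖ ^ 2) ^ (α - 2) * (1 - ‖w‖ ^ 2) ^ 2 := by
    rw [← Real.rpow_natCast (1 - ‖w‖ ^ 2), ← Real.rpow_add hwt]; norm_num
  have e3 : (‖1 - conj w * z‖ ^ 2) ^ (α - 2) = ‖1 - conj w * z‖ ^ (2 * α) / ‖1 - conj w * z‖ ^ 4 := by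
    rw [← Real.rpow_natCast, ← Real.rpow_natCast, ← Real.rpow_mul hu.le, ← Real.rpow_sub hu]
    congr 1
    push_cast
    ring
  rw [e1, e2, e3, Real.rpow_neg hu.le]
  have := Real.rpow_pos_of_pos hu (2 * α)
  field_simp

theorem weightedComp_zero (α p : ℝ) (w : ℂ) (f : ℂ → ℂ) : weightedComp α p w f 0 = f w := by
  simp [weightedComp, discInvolution]

theorem ofReal_norm_rpow_mul {α p : ℝ} {w : ℂ} (f : ℂ → ℂ) (hw : ‖w‖ < 1) :
    ENNReal.ofReal (‖f w‖ ^ p * (1 - ‖w‖ ^ 2) ^ α)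
      = ENNReal.ofReal ((1 - ‖w‖ ^ 2) ^ α)
        * ENNReal.ofReal (‖weightedComp α p w f 0‖ ^ p) := by
  have hwt : 0 < 1 - ‖w‖ ^ 2 := by nlinarith [norm_nonneg w]
  rw [weightedComp_zero, ← ENNReal.ofReal_mul (by positivity), mul_comm]

/-! ### Bound and equality for `α > 1` -/

theorem pointwise_bound_of_one_lt {α p : ℝ} (hα : 1 < α) (hp : 0 < p) {f : ℂ → ℂ}
    (hf : AnalyticOnNhd ℂ f (ball 0 1)) {w : ℂ} (hw : ‖w‖ < 1) :
    ENNReal.ofReal (‖f w‖ ^ p * (1 - ‖w‖ ^ 2) ^ α) ≤ dirichletNormPow α p f := by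
  refine le_trans ?_ (radialNormPow_le_dirichletNormPow hα hp hf)
  rw [radialNormPow_weightedComp hα hp hw hf, ofReal_norm_rpow_mul f hw]
  gcongr
  exact ofReal_le_radialNormPow hα hp (analyticOnNhd_weightedComp hw hf)

theorem exists_eq_cpow_of_one_lt {α p : ℝ} (hα : 1 < α) (hp : 0 < p) {f : ℂ → ℂ}
    (hf : AnalyticOnNhd ℂ f (ball 0 1)) {w : ℂ} (hw : ‖w‖ < 1)
    (heq : ENNReal.ofReal (‖f w‖ ^ p * (1 - ‖w‖ ^ 2) ^ α) = dirichletNormPow α p f) :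
    ∃ C : ℂ, ∀ z ∈ ball (0 : ℂ) 1,
      f z = C * (1 - conj w * z) ^ (((-2 * α / p : ℝ)) : ℂ) := by
  have hwt : 0 < 1 - ‖w‖ ^ 2 := by nlinarith [norm_nonneg w]
  have h1 := radialNormPow_le_dirichletNormPow hα hp hf
  rw [← heq, radialNormPow_weightedComp hα hp hw hf, ofReal_norm_rpow_mul f hw,
    ENNReal.mul_le_mul_iff_right (by simpa using Real.rpow_pos_of_pos hwt α)
      ENNReal.ofReal_ne_top] at h1
  have hF := analyticOnNhd_weightedComp (α := α) (p := p) hw hf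
  set β : ℝ := -2 * α / p with hβ
  have hr : (((1 - ‖w‖ ^ 2 : ℝ)) : ℂ) ≠ 0 := by exact_mod_cast hwt.ne'
  refine ⟨f w * (((1 - ‖w‖ ^ 2 : ℝ) : ℂ) ^ (β : ℂ))⁻¹, fun z hz => ?_⟩
  have hz' : ‖z‖ < 1 := by simpa using hz
  -- The constant function is evaluated at the image of `z`, because the involution returns `z`
  -- inside `f`.
  have h2 := eq_of_radialNormPow_le hα hp hF h1 (z := discInvolution w z)
    (by simpa using norm_discInvolution_lt_one hw hz')
  have hsl := one_sub_conj_mul_mem_slitPlane hw hz'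
  have hu := slitPlane_ne_zero hsl
  rw [weightedComp_zero, weightedComp, discInvolution_discInvolution hw hz',
    one_sub_conj_mul_discInvolution hw hz'] at h2
  -- The principal power is multiplicative here: one factor is a positive real, and the other is the
  -- inverse of a point of the slit plane.
  have h3 : (((1 - ‖w‖ ^ 2 : ℝ) : ℂ) * (1 - conj w * z)⁻¹) ^ (β : ℂ)
      = ((1 - ‖w‖ ^ 2 : ℝ) : ℂ) ^ (β : ℂ) * ((1 - conj w * z) ^ (β : ℂ))⁻¹ := by
    rw [cpow_def_of_ne_zero (mul_ne_zero hr (inv_ne_zero hu)), log_ofReal_mul hwt (inv_ne_zero hu),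
      add_mul, exp_add, ← inv_cpow _ _ (mem_slitPlane_iff_arg.1 hsl).1, cpow_def_of_ne_zero hr,
      cpow_def_of_ne_zero (inv_ne_zero hu), ofReal_log hwt.le]
  rw [← hβ, h3] at h2
  have h4 : ((1 - ‖w‖ ^ 2 : ℝ) : ℂ) ^ (β : ℂ) ≠ 0 := by
    rw [Ne, cpow_eq_zero_iff]; exact fun h => hr h.1
  have h5 : (1 - conj w * z) ^ (β : ℂ) ≠ 0 := by
    rw [Ne, cpow_eq_zero_iff]; exact fun h => hu h.1
  rw [← h2]
  field_simp

/-! ### Kernel functions attain equality -/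

theorem taylorCoeff_eq_of_hasSum {h : ℂ → ℂ} {a : ℕ → ℂ} {ρ : ℝ} (hρ : 0 < ρ)
    (hh : DifferentiableOn ℂ h (ball 0 ρ))
    (ha : ∀ z ∈ ball (0 : ℂ) ρ, HasSum (fun n => a n * z ^ n) (h z)) (n : ℕ) :
    taylorCoeff h n = a n := by
  have h1 := (hh.analyticAt (ball_mem_nhds 0 hρ)).hasFPowerSeriesAt
  have h2 : HasFPowerSeriesAt h (FormalMultilinearSeries.ofScalars ℂ a) 0 := by
    rw [hasFPowerSeriesAt_iff]
    filter_upwards [ball_mem_nhds (0 : ℂ) hρ] with z hz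
    simpa [mul_comm] using ha z hz
  have h3 := congrArg (fun q : FormalMultilinearSeries ℂ ℂ ℂ => q.coeff n)
    (h1.eq_formalMultilinearSeries h2)
  simp only [FormalMultilinearSeries.coeff_ofScalars] at h3
  rw [← h3, taylorCoeff, div_eq_inv_mul]

theorem dirichletNormPow_kernel {α p : ℝ} (hα : 0 < α) (hp : 0 < p) {f : ℂ → ℂ} {w C : ℂ}
    (hw : ‖w‖ < 1)
    (hf : ∀ z ∈ ball (0 : ℂ) 1, f z = C * (1 - conj w * z) ^ (((-2 * α / p : ℝ)) : ℂ)) :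
    dirichletNormPow α p f = ENNReal.ofReal (‖f w‖ ^ p * (1 - ‖w‖ ^ 2) ^ α) := by
  have hlt : 0 < 1 - ‖w‖ ^ 2 := by nlinarith [norm_nonneg w]
  have hw' : w ∈ ball (0 : ℂ) 1 := by simpa using hw
  -- Only moduli enter the norm, so a real `D` with `D² = ‖C‖ ^ p` replaces a branch of `C^(p/2)`;
  -- this also covers `C = 0`.
  set D : ℝ := ‖C‖ ^ (p / 2) with hD
  have hDC : D ^ 2 = ‖C‖ ^ p := by
    rw [hD, ← Real.rpow_natCast, ← Real.rpow_mul (norm_nonneg _)]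
    congr 1
    push_cast
    ring
  have hD0 : 0 ≤ D := by positivity
  let h : ℂ → ℂ := fun z => D * (1 - conj w * z) ^ ((-α : ℝ) : ℂ)
  have hsl : ∀ z ∈ ball (0 : ℂ) 1, 1 - conj w * z ∈ slitPlane := fun z hz =>
    one_sub_conj_mul_mem_slitPlane hw (by simpa using hz)
  have hh : DifferentiableOn ℂ h (ball 0 1) :=
    (DifferentiableOn.cpow_const (by fun_prop) hsl).const_mul _
  have hfh : ∀ z ∈ ball (0 : ℂ) 1, ‖f z‖ ^ p = ‖h z‖ ^ 2 := by
    intro z hz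
    simp only [h]
    rw [hf z hz, norm_mul, norm_mul, norm_cpow_real, norm_cpow_real, norm_real,
      Real.norm_of_nonneg hD0, mul_pow, hDC, Real.mul_rpow (norm_nonneg _) (by positivity),
      ← Real.rpow_mul (norm_nonneg _), ← Real.rpow_natCast (_ ^ (-α)),
      ← Real.rpow_mul (norm_nonneg _)]
    congr 2
    push_cast
    field_simp
  have hcoef : ∀ n, taylorCoeff h n = D * binomCoeff α n * conj w ^ n := by
    refine taylorCoeff_eq_of_hasSum one_pos hh fun z hz => ?_
    have hz' : ‖z‖ < 1 := by simpa using hz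
    have h1 := (hasSum_binomCoeff α (x := conj w * z) (by
      rw [norm_mul, norm_conj]
      nlinarith [norm_nonneg w, norm_nonneg z])).mul_left (D : ℂ)
    simp only [h]
    rw [ofReal_neg]
    refine h1.congr_fun fun n => ?_
    rw [mul_pow]
    ring
  have hsum := (hasSum_kernel_diag α hw).mul_left (D ^ 2)
  have hhw : ‖h w‖ ^ 2 * (1 - ‖w‖ ^ 2) ^ α = D ^ 2 * (1 - ‖w‖ ^ 2) ^ (-α) := by
    have h1 : 1 - conj w * w = ((1 - ‖w‖ ^ 2 : ℝ) : ℂ) := by push_cast; rw [conj_mul']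
    simp only [h]
    rw [norm_mul, norm_cpow_real, norm_real, Real.norm_of_nonneg hD0, h1, norm_real,
      Real.norm_of_nonneg hlt.le, Real.rpow_neg hlt.le]
    have := Real.rpow_pos_of_pos hlt α
    field_simp
  rw [← truncNormPow_one, truncNormPow_eq_tsum le_rfl one_pos hh hfh, hfh w hw', hhw,
    ← hsum.tsum_eq, ENNReal.ofReal_tsum_of_nonneg _ hsum.summable]
  · refine tsum_congr fun n => ?_
    have hb := binomCoeff_pos hα n
    rw [coeffWeight_one hα, ← ENNReal.ofReal_mul (by positivity), hcoef]
    congr 1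
    simp only [norm_mul, norm_pow, norm_real, norm_conj, Real.norm_of_nonneg hD0,
      Real.norm_of_nonneg hb.le]
    field_simp
    ring
  · intro n
    have hb := binomCoeff_pos hα n
    positivity

theorem analyticOnNhd_kernel {α p : ℝ} {f : ℂ → ℂ} {w C : ℂ} (hw : ‖w‖ < 1)
    (hf : ∀ z ∈ ball (0 : ℂ) 1, f z = C * (1 - conj w * z) ^ (((-2 * α / p : ℝ)) : ℂ)) :
    AnalyticOnNhd ℂ f (ball 0 1) := by
  refine DifferentiableOn.analyticOnNhd (DifferentiableOn.congr ?_ hf) isOpen_ball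
  exact (DifferentiableOn.cpow_const (by fun_prop) fun z hz =>
    one_sub_conj_mul_mem_slitPlane hw (by simpa using hz)).const_mul _

end

theorem corollary1p2 (α p : ℝ) (hα : 0 < α) (hp : 0 < p) :
    (∀ f ∈ dirichletClass α p, ∀ w ∈ Metric.ball (0 : ℂ) 1,
      ENNReal.ofReal (‖f w‖ ^ p * (1 - ‖w‖ ^ 2) ^ α) ≤ dirichletNormPow α p f) ∧
    (∀ f : ℂ → ℂ, ∀ w ∈ Metric.ball (0 : ℂ) 1,
      (f ∈ dirichletClass α p ∧
        ENNReal.ofReal (‖f w‖ ^ p * (1 - ‖w‖ ^ 2) ^ α) = dirichletNormPow α p f) ↔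
      ∃ C : ℂ, ∀ z ∈ Metric.ball (0 : ℂ) 1,
        f z = C * (1 - (starRingEnd ℂ) w * z) ^ (((-2 * α / p : ℝ)) : ℂ)) := by
  constructor
  · intro f hf w hw
    have hw' : ‖w‖ < 1 := by simpa using hw
    rcases le_or_gt α 1 with hα1 | hα1
    · exact pointwise_bound_of_le_one hα hα1 hp hf.1 hw'
    · exact pointwise_bound_of_one_lt hα1 hp hf.1 hw'
  · intro f w hw
    have hw' : ‖w‖ < 1 := by simpa using hw
    constructor
    · rintro ⟨hf, heq⟩
      rcases le_or_gt α 1 with hα1 | hα1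
      · exact exists_eq_cpow_of_le_one hα hα1 hp hf.1 hw' heq
      · exact exists_eq_cpow_of_one_lt hα1 hp hf.1 hw' heq
    · rintro ⟨C, hC⟩
      have h := dirichletNormPow_kernel hα hp hw' hC
      -- Membership in the class needs no separate estimate: the explicit value of the norm is
      -- finite.
      exact ⟨⟨analyticOnNhd_kernel hw' hC, h ▸ ENNReal.ofReal_lt_top⟩, h.symm⟩
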